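/- \textbf{Definitions.} Let $T_n,U_n$ be the Chebyshev polynomials of the first and second kind. For $x\in\mathbb R$ and $n\ge 0$ put $$\tilde T_n(x)=\begin{cases}T_n(x),&|x|\le 1,\\ (x-\operatorname{sgn}(x)\sqrt{x^2-1})^n,&|x|>1,\end{cases}$$ and let $W_n(x)=\sqrt{1-x^2}\,U_n(x)$, $V_n(x)=T_n(x)/\sqrt{1-x^2}$ for $|x|<1$, and $W_n(x)=V_n(x)=0$ for $|x|\ge 1$. Let $\tilde U_{-2}=\tilde U_{-1}=0$ on $[-1,1]$, and, for $|x|>1$, let $\tilde U_{-2}(x)=-|x|/\sqrt{x^2-1}$ and $\tilde U_{-1}(x)=-\operatorname{sgn}(x)/\sqrt{x^2-1}$. Let $\tilde U_0=\tilde T_0+\tilde U_{-2}$ and $\tilde U_n=2\tilde T_n+\tilde U_{n-2}$ for $n\ge 1$. For an interval $I=[a,b]$ with $a<b$ and a function $f$ on $\mathbb R$ put $f^I(x)=f\bigl(\tfrac{2}{b-a}(x-\tfrac{a+b}{2})\bigr)$. The square-root Laplacian is the principal value integral $$(-\Delta)^{1/2}u(x)=c_{1/2}\ \mathrm{p.v.}\!\!\int_{\mathbb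 R}\frac{u(x)-u(y)}{|x-y|^{2}}\,dy,\qquad c_s=\frac{4^s\,\Gamma(1/2+s)}{\pi^{1/2}|\Gamma(-s)|}$$ (so $c_{1/2}=1/\pi$). As a distribution, for $u\in L^2(\mathbb R)$, it is defined by $\langle(-\Delta)^{1/2}u,\varphi\rangle=\int_{\mathbb R}u\,(-\Delta)^{1/2}\varphi\,dx$ for all Schwartz functions $\varphi$. \textbf{Proposition (Sqrt-Laplacian).} Let $I=[a,b]$ with $a<b$. For every $n\ge 1$ and every $x\in\mathbb R\setminus\{a,b\}$, $$(-\Delta)^{1/2}[\tilde T^I_n](x)=\frac{2n}{b-a}\,V^I_n(x),$$ and for every $n\ge 0$ and every $x\in\mathbb R\setminus\{a,b\}$, $$(-\Delta)^{1/2}[W^I_n](x)=\frac{2(n+1)}{b-a}\,\tilde U^I_n(x).$$ Both identities hold pointwise, the principal value integrals being convergent for all such $x$. Moreover $\tilde T^I_n$ ($n\ge1$) and $W^I_n$ ($n\ge0$) belong to $L^2(\mathbb R)$, and both identities hold in the sense of distributions on $\mathbb R$, the right-hand sides being functions whose products with Schwartz functions are integrable. -/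

import Mathlib

open MeasureTheory Filter Topology
open scoped SchwartzMap

noncomputable section

namespace SumSpace

/-- The extended Chebyshev function of the first kind `T̃ₙ`. -/
def extT (n : ℕ) (x : ℝ) : ℝ :=
  if |x| ≤ 1 then (Polynomial.Chebyshev.T ℝ n).eval x
  else (x - Real.sign x * √(x ^ 2 - 1)) ^ n

/-- The weighted Chebyshev polynomial of the second kind `Wₙ(x) = (1 - x²)₊^{1/2} Uₙ(x)`,
extended to the real line by zero. -/
def wU (n : ℕ) (x : ℝ) : ℝ :=
  if |x| < 1 then √(1 - x ^ 2) * (Polynomial.Chebyshev.U ℝ n).eval x else 0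

/-- The weighted Chebyshev polynomial of the first kind `Vₙ(x) = (1 - x²)₊^{-1/2} Tₙ(x)`,
extended to the real line by zero. -/
def wT (n : ℕ) (x : ℝ) : ℝ :=
  if |x| < 1 then (Polynomial.Chebyshev.T ℝ n).eval x / √(1 - x ^ 2) else 0

/-- The function `Ũ₋₂`. -/
def extUNegTwo (x : ℝ) : ℝ :=
  if |x| ≤ 1 then 0 else -(|x| / √(x ^ 2 - 1))

/-- The function `Ũ₋₁`. -/
def extUNegOne (x : ℝ) : ℝ :=
  if |x| ≤ 1 then 0 else -(Real.sign x / √(x ^ 2 - 1))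

/-- The extended Chebyshev functions of the second kind: `Ũ₀ = T̃₀ + Ũ₋₂` and
`Ũₙ = 2 T̃ₙ + Ũₙ₋₂` for `n ≥ 1`. -/
def extU : ℕ → ℝ → ℝ
  | 0, x => extT 0 x + extUNegTwo x
  | 1, x => 2 * extT 1 x + extUNegOne x
  | n + 2, x => 2 * extT (n + 2) x + extU n x

/-- The transformed function `f^I(x) = f(y)`, `y = 2/(b-a) (x - (a+b)/2)`, for `I = [a,b]`. -/
def onInterval (a b : ℝ) (f : ℝ → ℝ) (x : ℝ) : ℝ :=
  f (2 / (b - a) * (x - (a + b) / 2))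

/-- The integral of `f` over the real line with the interval `[x-ε, x+ε]` removed. -/
def truncIntegral (f : ℝ → ℝ) (x ε : ℝ) : ℝ :=
  ∫ y in {y : ℝ | ε < |x - y|}, f y

/-- The Cauchy principal value integral of `f` over the real line, with singularity at `x`,
exists: all truncated integrals converge absolutely, and they have a finite limit. -/
def PVExists (f : ℝ → ℝ) (x : ℝ) : Prop :=
  (∀ ε : ℝ, 0 < ε → IntegrableOn f {y : ℝ | ε < |x - y|}) ∧
    ∃ L : ℝ, Tendsto (truncIntegral f x) (𝓝[>] 0) (𝓝 L)

/-- The value of the Cauchy principal value integral (meaningful when `PVExists f x`). -/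
def pvIntegral (f : ℝ → ℝ) (x : ℝ) : ℝ :=
  limUnder (𝓝[>] (0 : ℝ)) (truncIntegral f x)

/-- The normalising constant `c_s = 4^s Γ(1/2 + s) / (π^{1/2} |Γ(-s)|)`. -/
def fracLapConst (s : ℝ) : ℝ :=
  (4 : ℝ) ^ s * Real.Gamma (1 / 2 + s) / (√Real.pi * |Real.Gamma (-s)|)

/-- The integrand `y ↦ (u(x) - u(y)) / |x - y|^{1+2s}`. -/
def fracLapKernel (s : ℝ) (u : ℝ → ℝ) (x y : ℝ) : ℝ :=
  (u x - u y) / |x - y| ^ (1 + 2 * s)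

/-- The fractional Laplacian `(-Δ)^s u (x)` on the real line, as a singular integral
(meaningful when `PVExists (fracLapKernel s u x) x`). -/
def fracLaplacian (s : ℝ) (u : ℝ → ℝ) (x : ℝ) : ℝ :=
  fracLapConst s * pvIntegral (fracLapKernel s u x) x

/-- For `u ∈ L²(ℝ)`, the distribution `(-Δ)^s u`, which is defined by duality from the
singular integral on Schwartz functions `φ`, `⟨(-Δ)^s u, φ⟩ = ∫ u (-Δ)^s φ`,
is the function `g`. -/
def IsDistribFracLaplacian (s : ℝ) (u g : ℝ → ℝ) : Prop :=
  MemLp u 2 ∧ ∀ φ : 𝓢(ℝ, ℝ),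
    Integrable (fun x => u x * fracLaplacian s φ x) ∧
    Integrable (fun x => g x * φ x) ∧
    ∫ x, g x * φ x = ∫ x, u x * fracLaplacian s φ x

end SumSpace

end

/-!
The function `w(z) = z - √(z² - 1)` is holomorphic on the upper half-plane, continuous up to the
real line, and bounded by `1` and by `1 / |z|`. The boundary values of `F = wⁿ` are
`T̃ₙ - i Wₙ₋₁`, so both identities are the real and imaginary part of one statement about `F`: the
square-root Laplacian is the Dirichlet-to-Neumann map of the half-plane, hence sends `F` to `-i F'`,
where `F' = i n F / √(1 - z²)`. Outside `[-1, 1]`, the recursion defining `Ũₙ` telescopes to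
`-sgn(x) T̃ₙ₊₁ / √(x² - 1)`, which is what `F'` gives there (`extU_of_one_lt`).

For the pointwise statement, Cauchy's theorem is applied to `(F(z) - F(x)) / (z - x)²` on a
half-annulus about the real point `x`. Boundedness of `F` makes the outer semicircle disappear, and
`integral_Ioi_symmKernel_eq_semicircleSlope` expresses the singular integral truncated at `ε` by the
average of the difference quotient of `F` over the semicircle of radius `ε`. Its limit is `F'(x)`.

For the distributional statement, the operator is moved from a Schwartz function to `u` at each
fixed truncation, by Fubini's theorem and translation invariance; then `ε → 0` is taken under the
integral (`isDistribFracLaplacian_of_dominated`). The semicircle formula supplies the dominating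
function: the truncated integrals are at most `π C` whenever `|F(z) - F(x)| ≤ C |z - x|` for all `z`,
and `C` can be taken of order `|x - 1|^{-1/2} + |x + 1|^{-1/2}` (`norm_invJoukowsky_sub_le`), which is
locally integrable.
-/

namespace SumSpace

/-! ### The normalising constant and the symmetrised singular integral -/

theorem fracLapConst_half : fracLapConst (1 / 2) = Real.pi⁻¹ := by
  have h := Real.Gamma_add_one (s := -(1 / 2 : ℝ)) (by norm_num)
  have h2 : -(1 / 2 : ℝ) + 1 = 1 / 2 := by norm_num
  rw [h2, Real.Gamma_one_half_eq] at h
  have h3 : Real.Gamma (-(1 / 2)) = -(2 * √Real.pi) := by linarith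
  have h4 : (4 : ℝ) ^ (1 / 2 : ℝ) = 2 := by
    rw [← Real.sqrt_eq_rpow, show (4 : ℝ) = 2 ^ 2 by norm_num, Real.sqrt_sq (by norm_num)]
  have h5 : 0 < √Real.pi := Real.sqrt_pos.2 Real.pi_pos
  rw [fracLapConst, h3, h4, abs_neg, abs_of_pos (by positivity),
    show (1 / 2 + 1 / 2 : ℝ) = 1 by norm_num, Real.Gamma_one]
  have h6 : √Real.pi * √Real.pi = Real.pi := Real.mul_self_sqrt Real.pi_pos.le
  rw [show √Real.pi * (2 * √Real.pi) = 2 * Real.pi by linear_combination 2 * h6]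
  field_simp

theorem fracLapKernel_half (u : ℝ → ℝ) (x y : ℝ) :
    fracLapKernel (1 / 2) u x y = ((y - x) ^ 2)⁻¹ * (u x - u y) := by
  rw [fracLapKernel, show (1 + 2 * (1 / 2) : ℝ) = (2 : ℕ) by norm_num, Real.rpow_natCast, sq_abs,
    show (x - y) ^ 2 = (y - x) ^ 2 by ring, div_eq_inv_mul]

section symmKernel

variable {E : Type*} [NormedAddCommGroup E] [NormedSpace ℝ E]

/-- The symmetrised kernel `(2 u(x) - u(x + t) - u(x - t)) / t²` of the square-root Laplacian. -/
noncomputable def symmKernel (u : ℝ → E) (x t : ℝ) : E :=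
  (t ^ 2)⁻¹ • ((u x - u (x + t)) + (u x - u (x - t)))

theorem integrableOn_inv_sq {ε : ℝ} (hε : 0 < ε) :
    IntegrableOn (fun t : ℝ => (t ^ 2)⁻¹) (Set.Ioi ε) := by
  refine (integrableOn_Ioi_rpow_of_lt (a := -2) (by norm_num) hε).congr_fun ?_ measurableSet_Ioi
  intro t ht
  have : (0 : ℝ) < t := hε.trans ht
  simp only
  rw [Real.rpow_neg this.le]
  norm_num

theorem integrableOn_inv_sq_smul {v : ℝ → E} {M ε : ℝ} (hv : Continuous v)
    (hM : ∀ t, ‖v t‖ ≤ M) (hε : 0 < ε) :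
    IntegrableOn (fun t : ℝ => (t ^ 2)⁻¹ • v t) (Set.Ioi ε) := by
  refine ((integrableOn_inv_sq hε).mul_const M).mono' ?_ ?_
  · refine AEStronglyMeasurable.smul ?_ hv.aestronglyMeasurable
    exact (by fun_prop : Measurable fun t : ℝ => (t ^ 2)⁻¹).aestronglyMeasurable
  · refine Eventually.of_forall fun t => ?_
    rw [norm_smul, Real.norm_of_nonneg (by positivity)]
    gcongr
    exact hM t

theorem integrableOn_symmKernel {u : ℝ → E} {M ε : ℝ} (hu : Continuous u)
    (hM : ∀ t, ‖u t‖ ≤ M) (x : ℝ) (hε : 0 < ε) :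
    IntegrableOn (symmKernel u x) (Set.Ioi ε) := by
  refine integrableOn_inv_sq_smul (M := M + M + (M + M)) (by fun_prop) (fun t => ?_) hε
  refine (norm_add_le _ _).trans ?_
  gcongr <;> refine (norm_sub_le _ _).trans ?_ <;> gcongr <;> exact hM _

theorem norm_symmKernel_le {u : ℝ → E} {M : ℝ} (hM : ∀ t, ‖u t‖ ≤ M) (x t : ℝ) :
    ‖symmKernel u x t‖ ≤ (t ^ 2)⁻¹ * (4 * M) := by
  rw [symmKernel, norm_smul, Real.norm_of_nonneg (by positivity)]
  gcongr
  have := hM x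
  have := hM (x + t)
  have := hM (x - t)
  have h1 := norm_sub_le (u x) (u (x + t))
  have h2 := norm_sub_le (u x) (u (x - t))
  have h3 := norm_add_le (u x - u (x + t)) (u x - u (x - t))
  linarith

end symmKernel

theorem setOf_lt_abs_sub (x ε : ℝ) :
    {y : ℝ | ε < |x - y|} = (fun y => y - x) ⁻¹' (Set.Iio (-ε) ∪ Set.Ioi ε) := by
  ext y
  simp only [Set.mem_ofPred_eq, Set.mem_preimage, Set.mem_union, Set.mem_Iio, Set.mem_Ioi,
    lt_abs]
  constructor <;> rintro (h | h) <;> [left; right; left; right] <;> linarith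

theorem integrableOn_Iio_neg_inv_sq_mul {v : ℝ → ℝ} {M ε : ℝ} (hv : Continuous v)
    (hM : ∀ t, ‖v t‖ ≤ M) (hε : 0 < ε) :
    IntegrableOn (fun t : ℝ => (t ^ 2)⁻¹ * v t) (Set.Iio (-ε)) := by
  have h := integrableOn_inv_sq_smul (v := fun t => v (-t)) (by fun_prop) (fun t => hM (-t)) hε
  rw [← (Measure.measurePreserving_neg (volume : Measure ℝ)).integrableOn_comp_preimage
    (MeasurableEquiv.neg ℝ).measurableEmbedding] 
  refine (h.congr_fun (fun t _ => ?_) measurableSet_Ioi).mono_set ?_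
  · simp
  · intro t ht
    simpa using ht

theorem integrableOn_fracLapKernel {u : ℝ → ℝ} {M ε : ℝ} (hu : Continuous u)
    (hM : ∀ t, ‖u t‖ ≤ M) (x : ℝ) (hε : 0 < ε) :
    IntegrableOn (fracLapKernel (1 / 2) u x) {y : ℝ | ε < |x - y|} := by
  have hb (t : ℝ) : ‖u x - u (x + t)‖ ≤ M + M := (norm_sub_le _ _).trans (add_le_add (hM _) (hM _))
  have h : IntegrableOn (fun t : ℝ => (t ^ 2)⁻¹ * (u x - u (x + t)))
      (Set.Iio (-ε) ∪ Set.Ioi ε) :=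
    (integrableOn_Iio_neg_inv_sq_mul (by fun_prop) hb hε).union
      (integrableOn_inv_sq_smul (by fun_prop) hb hε)
  rw [setOf_lt_abs_sub]
  refine (((measurePreserving_sub_right (volume : Measure ℝ) x).integrableOn_comp_preimage
    (MeasurableEquiv.subRight x).measurableEmbedding).2 h).congr_fun ?_ ?_
  · intro y _
    simp only [Function.comp, fracLapKernel_half, add_sub_cancel]
  · exact measurable_sub_const x (measurableSet_Iio.union measurableSet_Ioi)

/-- Folding the two half-lines onto each other turns the truncated singular integral into an
integral of the symmetrised kernel over a half-line. -/
theorem truncIntegral_fracLapKernel {u : ℝ → ℝ} {M ε : ℝ} (hu : Continuous u)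
    (hM : ∀ t, ‖u t‖ ≤ M) (x : ℝ) (hε : 0 < ε) :
    truncIntegral (fracLapKernel (1 / 2) u x) x ε = ∫ t in Set.Ioi ε, symmKernel u x t := by
  have hb (t : ℝ) : ‖u x - u (x + t)‖ ≤ M + M := (norm_sub_le _ _).trans (add_le_add (hM _) (hM _))
  have hb' (t : ℝ) : ‖u x - u (x - t)‖ ≤ M + M := (norm_sub_le _ _).trans (add_le_add (hM _) (hM _))
  have h1 := integrableOn_Iio_neg_inv_sq_mul (v := fun t => u x - u (x + t)) (by fun_prop) hb hε
  have h2 := integrableOn_inv_sq_smul (v := fun t => u x - u (x + t)) (by fun_prop) hb hε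
  have h3 := integrableOn_inv_sq_smul (v := fun t => u x - u (x - t)) (by fun_prop) hb' hε
  have e1 : truncIntegral (fracLapKernel (1 / 2) u x) x ε =
      ∫ t in Set.Iio (-ε) ∪ Set.Ioi ε, (t ^ 2)⁻¹ * (u x - u (x + t)) := by
    rw [truncIntegral, setOf_lt_abs_sub]
    refine Eq.trans ?_ ((measurePreserving_sub_right (volume : Measure ℝ) x).setIntegral_preimage_emb
      (MeasurableEquiv.subRight x).measurableEmbedding
      (fun t => (t ^ 2)⁻¹ * (u x - u (x + t))) (Set.Iio (-ε) ∪ Set.Ioi ε))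
    refine setIntegral_congr_fun
      (measurable_sub_const x (measurableSet_Iio.union measurableSet_Ioi)) fun y _ => ?_
    simp only [fracLapKernel_half, add_sub_cancel]
  have e2 : ∫ t in Set.Iio (-ε), (t ^ 2)⁻¹ * (u x - u (x + t)) =
      ∫ t in Set.Ioi ε, (t ^ 2)⁻¹ * (u x - u (x - t)) := by
    have := integral_comp_neg_Ioi ε fun t : ℝ => (t ^ 2)⁻¹ * (u x - u (x + t))
    rw [← (integral_Iic_eq_integral_Iio :
      _ = ∫ t in Set.Iio (-ε), (t ^ 2)⁻¹ * (u x - u (x + t))), ← this]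
    simp [sub_eq_add_neg]
  rw [e1, setIntegral_union _ measurableSet_Ioi h1 h2, e2, add_comm]
  · refine (integral_add h2 h3).symm.trans ?_
    refine integral_congr_ae (Eventually.of_forall fun t => ?_)
    simp [symmKernel, mul_add]
  · rw [Set.disjoint_left]
    intro t ht ht'
    simp only [Set.mem_Iio, Set.mem_Ioi] at ht ht'
    linarith

/-- A limit of the integrals of the symmetrised kernel is the principal value. -/
theorem pvExists_and_fracLaplacian_eq {u : ℝ → ℝ} {M L x : ℝ} (hu : Continuous u)
    (hM : ∀ t, ‖u t‖ ≤ M)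
    (h : Tendsto (fun ε => ∫ t in Set.Ioi ε, symmKernel u x t) (𝓝[>] 0) (𝓝 L)) :
    PVExists (fracLapKernel (1 / 2) u x) x ∧ fracLaplacian (1 / 2) u x = Real.pi⁻¹ * L := by
  have h' : Tendsto (truncIntegral (fracLapKernel (1 / 2) u x) x) (𝓝[>] 0) (𝓝 L) := by
    refine h.congr' ?_
    filter_upwards [self_mem_nhdsWithin] with ε hε
    exact (truncIntegral_fracLapKernel hu hM x hε).symm
  refine ⟨⟨fun ε hε => integrableOn_fracLapKernel hu hM x hε, L, h'⟩, ?_⟩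
  rw [fracLaplacian, pvIntegral, h'.limUnder_eq, fracLapConst_half]

/-! ### Cauchy's theorem on a half-annulus -/

/-- The average of the difference quotients of `F` at the real point `x` over the upper semicircle
of radius `r` about `x`, multiplied by `π`. -/
noncomputable def semicircleSlope (F : ℂ → ℂ) (x r : ℝ) : ℂ :=
  ∫ θ in (0 : ℝ)..Real.pi,
    (F (x + r * Complex.exp (θ * Complex.I)) - F x) / (r * Complex.exp (θ * Complex.I))

theorem im_add_mul_exp_nonneg (x : ℝ) {r θ : ℝ} (hr : 0 ≤ r) (h0 : 0 ≤ θ) (hπ : θ ≤ Real.pi) :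
    0 ≤ ((x : ℂ) + r * Complex.exp (θ * Complex.I)).im := by
  have := Real.sin_nonneg_of_nonneg_of_le_pi h0 hπ
  rw [Complex.add_im, Complex.ofReal_im, Complex.im_ofReal_mul, Complex.exp_ofReal_mul_I_im]
  positivity

theorem norm_ofReal_mul_exp {r : ℝ} (hr : 0 < r) (θ : ℝ) :
    ‖(r : ℂ) * Complex.exp (θ * Complex.I)‖ = r := by
  rw [norm_mul, Complex.norm_exp_ofReal_mul_I, mul_one, Complex.norm_real, Real.norm_of_nonneg hr.le]

/-- Cauchy's theorem in a half-annulus of the closed upper half-plane centred at a real point,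
obtained from the rectangle case in exponential polar coordinates. -/
theorem integral_symmKernel_eq_semicircleSlope {F : ℂ → ℂ} (hc : ContinuousOn F {z | 0 ≤ z.im})
    (hd : DifferentiableOn ℂ F {z | 0 < z.im}) (x : ℝ) {ε R : ℝ} (hε : 0 < ε) (hR : ε ≤ R) :
    ∫ t in ε..R, symmKernel (fun y : ℝ => F y) x t =
      -Complex.I * (semicircleSlope F x ε - semicircleSlope F x R) := by
  have hR0 : 0 < R := hε.trans_le hR
  have hlog : Real.log ε ≤ Real.log R := Real.log_le_log hε hR
  -- The form `(F z - F x) / (z - x) ^ 2 dz` in the coordinate `z = x + exp ζ`, which maps the strip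
  -- `0 ≤ im ζ ≤ π` to the upper half-plane, its two edges to the two half-lines from `x`.
  set h : ℂ → ℂ := fun ζ => (F (x + Complex.exp ζ) - F x) * Complex.exp (-ζ) with h_def
  have key := Complex.integral_boundary_rect_eq_zero_of_continuousOn_of_differentiableOn h
    ⟨Real.log ε, 0⟩ ⟨Real.log R, Real.pi⟩ ?_ ?_
  · have semi : ∀ r : ℝ, 0 < r →
        ∫ y : ℝ in (0 : ℝ)..Real.pi, h ((Real.log r : ℝ) + y * Complex.I) = semicircleSlope F x r := by
      intro r hr
      refine intervalIntegral.integral_congr fun θ _ => ?_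
      simp only [h_def, Complex.exp_neg, Complex.exp_add, ← Complex.ofReal_exp, Real.exp_log hr,
        div_eq_mul_inv]
    have bot : ∀ s : ℝ, h (s + (0 : ℝ) * Complex.I) =
        (F (x + Real.exp s : ℝ) - F x) * ((Real.exp s)⁻¹ : ℝ) := by
      intro s
      simp [h_def, Complex.exp_neg]
    have top : ∀ s : ℝ, h (s + (Real.pi : ℝ) * Complex.I) =
        -((F (x - Real.exp s : ℝ) - F x) * ((Real.exp s)⁻¹ : ℝ)) := by
      intro s
      simp [h_def, Complex.exp_neg, Complex.exp_add, sub_eq_add_neg]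
    have hcr : Continuous fun y : ℝ => F y :=
      hc.comp_continuous Complex.continuous_ofReal fun y => by simp
    have cb : Continuous fun s : ℝ => h (s + (0 : ℝ) * Complex.I) := by
      simp only [bot]
      refine ((hcr.comp (by fun_prop)).sub continuous_const).mul
        (Complex.continuous_ofReal.comp (Real.continuous_exp.inv₀ fun s => (Real.exp_pos s).ne'))
    have ct : Continuous fun s : ℝ => h (s + (Real.pi : ℝ) * Complex.I) := by
      simp only [top]
      refine (((hcr.comp (by fun_prop)).sub continuous_const).mul
        (Complex.continuous_ofReal.comp
          (Real.continuous_exp.inv₀ fun s => (Real.exp_pos s).ne'))).neg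
    have hsub : ∫ s in Real.log ε..Real.log R,
        Real.exp s • (symmKernel (fun y : ℝ => F y) x ∘ Real.exp) s =
        ∫ t in ε..R, symmKernel (fun y : ℝ => F y) x t := by
      have := intervalIntegral.integral_deriv_smul_comp' (a := Real.log ε) (b := Real.log R)
        (g := symmKernel (fun y : ℝ => F y) x)
        (fun s _ => Real.hasDerivAt_exp s) Real.continuous_exp.continuousOn ?_
      · rwa [Real.exp_log hε, Real.exp_log hR0] at this
      · have : ContinuousOn (symmKernel (fun y : ℝ => F y) x) (Set.Ioi 0) := by
          have hinv : ContinuousOn (fun t : ℝ => (t ^ 2)⁻¹) (Set.Ioi 0) :=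
            (continuous_pow 2).continuousOn.inv₀ fun t ht => pow_ne_zero 2 (ne_of_gt ht)
          have hnum : Continuous fun t : ℝ => (F x - F (x + t : ℝ)) + (F x - F (x - t : ℝ)) :=
            (continuous_const.sub (hcr.comp (by fun_prop))).add
              (continuous_const.sub (hcr.comp (by fun_prop)))
          exact hinv.smul hnum.continuousOn
        refine this.mono ?_
        rintro _ ⟨s, -, rfl⟩
        exact Real.exp_pos s
    have hsum : ∫ s in Real.log ε..Real.log R,
        Real.exp s • (symmKernel (fun y : ℝ => F y) x ∘ Real.exp) s =
        -((∫ s : ℝ in Real.log ε..Real.log R, h (s + (0 : ℝ) * Complex.I)) -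
          ∫ s : ℝ in Real.log ε..Real.log R, h (s + (Real.pi : ℝ) * Complex.I)) := by
      rw [← intervalIntegral.integral_sub (cb.intervalIntegrable _ _) (ct.intervalIntegrable _ _),
        ← intervalIntegral.integral_neg]
      refine intervalIntegral.integral_congr fun s _ => ?_
      have hs : (Complex.exp s : ℂ) ≠ 0 := Complex.exp_ne_zero _
      simp only [bot, top, symmKernel, Function.comp, Complex.real_smul, Complex.ofReal_inv,
        Complex.ofReal_pow, Complex.ofReal_exp]
      field_simp
      ring
    simp only [smul_eq_mul] at key
    rw [semi R hR0, semi ε hε] at key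
    rw [← hsub, hsum]
    linear_combination -key
  · refine ContinuousOn.mul (ContinuousOn.sub (hc.comp (by fun_prop) ?_) continuousOn_const)
      (by fun_prop)
    rintro ζ ⟨-, hζ⟩
    simp only [Set.uIcc_of_le Real.pi_pos.le, Set.mem_preimage, Set.mem_Icc] at hζ
    simp only [Set.mem_ofPred_eq, Complex.add_im, Complex.ofReal_im, Complex.exp_im, zero_add]
    exact mul_nonneg (Real.exp_pos _).le (Real.sin_nonneg_of_nonneg_of_le_pi hζ.1 hζ.2)
  · refine DifferentiableOn.mul (DifferentiableOn.sub_const (hd.comp (by fun_prop) ?_) _)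
      (by fun_prop)
    rintro ζ ⟨-, hζ⟩
    simp only [min_eq_left Real.pi_pos.le, max_eq_right Real.pi_pos.le, Set.mem_preimage,
      Set.mem_Ioo] at hζ
    simp only [Set.mem_ofPred_eq, Complex.add_im, Complex.ofReal_im, Complex.exp_im, zero_add]
    exact mul_pos (Real.exp_pos _) (Real.sin_pos_of_pos_of_lt_pi hζ.1 hζ.2)

theorem norm_semicircleSlope_le {F : ℂ → ℂ} {x r C : ℝ} (hr : 0 < r)
    (hC : ∀ z : ℂ, 0 ≤ z.im → ‖z - x‖ = r → ‖F z - F x‖ ≤ C * r) :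
    ‖semicircleSlope F x r‖ ≤ C * Real.pi := by
  have := intervalIntegral.norm_integral_le_of_norm_le_const (a := (0 : ℝ)) (b := Real.pi)
    (C := C) (f := fun θ : ℝ =>
    (F (x + r * Complex.exp (θ * Complex.I)) - F x) / (r * Complex.exp (θ * Complex.I))) ?_
  · rwa [sub_zero, abs_of_pos Real.pi_pos] at this
  · intro θ hθ
    rw [Set.uIoc_of_le Real.pi_pos.le] at hθ
    rw [norm_div, norm_ofReal_mul_exp hr, div_le_iff₀ hr]
    refine hC _ (im_add_mul_exp_nonneg x hr.le hθ.1.le hθ.2) ?_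
    rw [add_sub_cancel_left, norm_ofReal_mul_exp hr]

theorem tendsto_semicircleSlope_atTop {F : ℂ → ℂ} {M : ℝ} (hM : ∀ z : ℂ, 0 ≤ z.im → ‖F z‖ ≤ M)
    (x : ℝ) : Tendsto (semicircleSlope F x) atTop (𝓝 0) := by
  have h : Tendsto (fun r : ℝ => (2 * M * Real.pi) * r⁻¹) atTop (𝓝 0) := by
    simpa using tendsto_inv_atTop_zero.const_mul (2 * M * Real.pi)
  refine squeeze_zero_norm' ?_ h
  filter_upwards [eventually_gt_atTop 0] with r hr
  refine (norm_semicircleSlope_le (C := 2 * M * r⁻¹) hr fun z hz _ => ?_).trans (by linarith)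
  rw [inv_mul_cancel_right₀ hr.ne']
  refine (norm_sub_le _ _).trans ?_
  linarith [hM z hz, hM x (by simp)]

theorem integral_Ioi_symmKernel_eq_semicircleSlope {F : ℂ → ℂ} {M : ℝ}
    (hc : ContinuousOn F {z | 0 ≤ z.im}) (hd : DifferentiableOn ℂ F {z | 0 < z.im})
    (hM : ∀ z : ℂ, 0 ≤ z.im → ‖F z‖ ≤ M) (x : ℝ) {ε : ℝ} (hε : 0 < ε) :
    ∫ t in Set.Ioi ε, symmKernel (fun y : ℝ => F y) x t =
      -Complex.I * semicircleSlope F x ε := by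
  have hcr : Continuous fun y : ℝ => F y :=
    hc.comp_continuous Complex.continuous_ofReal fun y => by simp
  have h1 := intervalIntegral_tendsto_integral_Ioi ε
    (integrableOn_symmKernel hcr (fun t => hM t (by simp)) x hε) tendsto_id
  have h2 := ((tendsto_semicircleSlope_atTop hM x).const_sub (semicircleSlope F x ε)).const_mul
    (-Complex.I)
  rw [sub_zero] at h2
  refine tendsto_nhds_unique h1 (h2.congr' ?_)
  filter_upwards [eventually_ge_atTop ε] with R hR
  exact (integral_symmKernel_eq_semicircleSlope hc hd x hε hR).symm

theorem tendsto_semicircleSlope_zero {F : ℂ → ℂ} {F' : ℂ} {x : ℝ}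
    (hc : ContinuousOn F {z | 0 ≤ z.im}) (hF : HasDerivWithinAt F F' {z | 0 ≤ z.im} x) :
    Tendsto (semicircleSlope F x) (𝓝[>] 0) (𝓝 (F' * Real.pi)) := by
  rw [Metric.tendsto_nhds]
  intro δ hδ
  have hδ' : 0 < δ / (2 * Real.pi) := by positivity
  have h1 := (hasDerivWithinAt_iff_isLittleO.1 hF).def hδ'
  rw [eventually_nhdsWithin_iff, Metric.eventually_nhds_iff] at h1
  obtain ⟨η, hη, h1⟩ := h1
  filter_upwards [Ioo_mem_nhdsGT hη] with r hr
  have hint : IntervalIntegrable (fun θ : ℝ =>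
      (F (x + r * Complex.exp (θ * Complex.I)) - F x) / (r * Complex.exp (θ * Complex.I)))
      volume 0 Real.pi := by
    refine ContinuousOn.intervalIntegrable ?_
    refine ContinuousOn.div ((hc.comp (by fun_prop) ?_).sub continuousOn_const) (by fun_prop) ?_
    · intro θ hθ
      rw [Set.uIcc_of_le Real.pi_pos.le] at hθ
      exact im_add_mul_exp_nonneg x hr.1.le hθ.1 hθ.2
    · intro θ _ h0
      have := norm_ofReal_mul_exp hr.1 θ
      rw [h0, norm_zero] at this
      exact hr.1.ne this
  have hconst : F' * Real.pi = ∫ θ in (0 : ℝ)..Real.pi, F' := by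
    rw [intervalIntegral.integral_const, sub_zero, Complex.real_smul, mul_comm]
  rw [dist_eq_norm, hconst, semicircleSlope,
    ← intervalIntegral.integral_sub hint intervalIntegrable_const]
  refine (intervalIntegral.norm_integral_le_of_norm_le_const (C := δ / (2 * Real.pi)) ?_).trans_lt ?_
  · intro θ hθ
    rw [Set.uIoc_of_le Real.pi_pos.le] at hθ
    have hn := norm_ofReal_mul_exp hr.1 θ
    have hne : (r : ℂ) * Complex.exp (θ * Complex.I) ≠ 0 := by
      rw [← norm_pos_iff, hn]; exact hr.1
    have h2 := @h1 (x + r * Complex.exp (θ * Complex.I)) (by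
      rw [dist_eq_norm, add_sub_cancel_left, hn]; exact hr.2)
      (im_add_mul_exp_nonneg x hr.1.le hθ.1.le hθ.2)
    rw [add_sub_cancel_left, hn, smul_eq_mul] at h2
    rw [div_sub' hne, norm_div, hn, div_le_iff₀ hr.1]
    exact h2
  · rw [sub_zero, abs_of_pos Real.pi_pos]
    have := Real.pi_pos
    field_simp
    linarith

/-! ### Moving the operator off a Schwartz function -/

theorem SchwartzMap.exists_abs_le_inv_one_add_sq (φ : 𝓢(ℝ, ℝ)) :
    ∃ C : ℝ, 0 ≤ C ∧ ∀ x, |φ x| ≤ C * (1 + x ^ 2)⁻¹ := by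
  obtain ⟨C0, -, hC0⟩ := φ.decay 0 0
  obtain ⟨C2, -, hC2⟩ := φ.decay 2 0
  have h (x : ℝ) : |φ x| * (1 + x ^ 2) ≤ C0 + C2 := by
    have h0 := hC0 x
    have h2 := hC2 x
    simp only [norm_iteratedFDeriv_zero, Real.norm_eq_abs, pow_zero, one_mul, sq_abs] at h0 h2
    linarith
  refine ⟨C0 + C2, le_trans (by positivity) (h 0), fun x => ?_⟩
  rw [← div_eq_mul_inv, le_div_iff₀ (by positivity)]
  exact h x

/-- Twice applying the mean value inequality bounds the second difference of a Schwartz function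
by its second derivative, which decays. -/
theorem SchwartzMap.exists_norm_symmKernel_le (φ : 𝓢(ℝ, ℝ)) :
    ∃ C : ℝ, ∀ x t : ℝ, 0 < t → t ≤ 1 → ‖symmKernel φ x t‖ ≤ C * (1 + x ^ 2)⁻¹ := by
  set φ' := SchwartzMap.derivCLM ℝ ℝ φ with hφ'
  set φ'' := SchwartzMap.derivCLM ℝ ℝ φ' with hφ''
  have d1 (y : ℝ) : HasDerivAt φ (φ' y) y := by
    rw [hφ', SchwartzMap.derivCLM_apply]; exact φ.differentiable.differentiableAt.hasDerivAt
  have d2 (y : ℝ) : HasDerivAt φ' (φ'' y) y := by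
    rw [hφ'', SchwartzMap.derivCLM_apply]; exact φ'.differentiable.differentiableAt.hasDerivAt
  obtain ⟨C, hC0, hC⟩ := SchwartzMap.exists_abs_le_inv_one_add_sq φ''
  refine ⟨2 * (3 * C), fun x t ht ht1 => ?_⟩
  set B := 3 * C * (1 + x ^ 2)⁻¹ with hB
  have hB0 : 0 ≤ B := by positivity
  -- The factor `3` comes from `1 + x ^ 2 ≤ 3 * (1 + y ^ 2)` for `|y - x| ≤ 1`.
  have b2 : ∀ y ∈ Set.Icc (x - t) (x + t), ‖φ'' y‖ ≤ B := by
    intro y hy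
    refine (hC y).trans ?_
    rw [hB, mul_assoc, mul_left_comm]
    gcongr
    rw [← div_eq_mul_inv, le_div_iff₀ (by positivity), inv_mul_le_iff₀ (by positivity)]
    have : |y - x| ≤ 1 := abs_le.2 ⟨by linarith [hy.1], by linarith [hy.2]⟩
    have := (sq_le_one_iff_abs_le_one _).2 this
    nlinarith [sq_nonneg (2 * y - x)]
  have b1 : ∀ s ∈ Set.Icc 0 t, ‖φ' (x + s) - φ' (x - s)‖ ≤ B * (2 * t) := by
    intro s hs
    refine ((convex_Icc (x - t) (x + t)).norm_image_sub_le_of_norm_hasDerivWithin_le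
      (fun y _ => (d2 y).hasDerivWithinAt) b2 (x := x - s) (y := x + s)
      ⟨by linarith [hs.2], by linarith [hs.1]⟩ ⟨by linarith [hs.1], by linarith [hs.2]⟩).trans ?_
    gcongr
    rw [show x + s - (x - s) = 2 * s by ring, Real.norm_of_nonneg (by linarith [hs.1])]
    linarith [hs.2]
  have d3 (s : ℝ) : HasDerivAt (fun s => φ (x + s) + φ (x - s)) (φ' (x + s) - φ' (x - s)) s :=
    ((d1 (x + s)).comp_const_add x s).add ((d1 (x - s)).comp_const_sub x s)
  have h := (convex_Icc 0 t).norm_image_sub_le_of_norm_hasDerivWithin_le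
    (fun s _ => (d3 s).hasDerivWithinAt) b1 (x := 0) (y := t)
    (Set.left_mem_Icc.2 ht.le) (Set.right_mem_Icc.2 ht.le)
  rw [symmKernel, norm_smul, Real.norm_of_nonneg (by positivity), inv_mul_le_iff₀ (by positivity)]
  simp only [sub_zero, add_zero, Real.norm_of_nonneg ht.le] at h
  rw [← norm_neg]
  calc _ = ‖φ (x + t) + φ (x - t) - (φ x + φ x)‖ := by congr 1; ring
    _ ≤ B * (2 * t) * t := h
    _ = _ := by rw [hB]; ring

theorem measurable_uncurry_symmKernel {u : ℝ → ℝ} (hu : Continuous u) :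
    Measurable fun p : ℝ × ℝ => symmKernel u p.1 p.2 := by
  have := hu.measurable
  unfold symmKernel
  fun_prop

/-- The symmetrised kernel of a Schwartz function is absolutely integrable in both variables. -/
theorem integrable_symmKernel_schwartz (φ : 𝓢(ℝ, ℝ)) :
    Integrable (fun p : ℝ × ℝ => symmKernel φ p.1 p.2)
      (volume.prod (volume.restrict (Set.Ioi 0))) := by
  have hm := measurable_uncurry_symmKernel φ.continuous
  have hφ : Integrable φ := φ.integrable
  have hx (t : ℝ) : Integrable fun x => symmKernel φ x t :=
    ((hφ.sub (hφ.comp_add_right t)).add (hφ.sub (hφ.comp_sub_right t))).smul (t ^ 2)⁻¹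
  have hN : StronglyMeasurable fun t : ℝ => ∫ x, ‖symmKernel φ x t‖ :=
    hm.stronglyMeasurable.norm.integral_prod_left'
  refine (integrable_prod_iff' hm.aestronglyMeasurable).2 ⟨Eventually.of_forall hx, ?_⟩
  obtain ⟨C, hC⟩ := SchwartzMap.exists_norm_symmKernel_le φ
  change IntegrableOn (fun t : ℝ => ∫ x, ‖symmKernel φ x t‖) (Set.Ioi 0)
  rw [← Set.Ioc_union_Ioi_eq_Ioi (zero_le_one' ℝ)]
  refine IntegrableOn.union ?_ ?_
  · refine Measure.integrableOn_of_bounded (M := ∫ x : ℝ, C * (1 + x ^ 2)⁻¹) (by simp)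
      hN.aestronglyMeasurable ?_
    refine (ae_restrict_iff' measurableSet_Ioc).2 (Eventually.of_forall fun t ht => ?_)
    rw [Real.norm_of_nonneg (integral_nonneg fun x => norm_nonneg _)]
    exact integral_mono (hx t).norm (integrable_inv_one_add_sq.const_mul C)
      fun x => hC x t ht.1 ht.2
  · refine ((integrableOn_inv_sq one_pos).mul_const (4 * ∫ x, ‖φ x‖)).mono'
      hN.aestronglyMeasurable (Eventually.of_forall fun t => ?_)
    rw [Real.norm_of_nonneg (integral_nonneg fun x => norm_nonneg _)]
    have i1 := hφ.norm
    have i2 := hφ.norm.comp_add_right t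
    have i3 := hφ.norm.comp_sub_right t
    calc ∫ x, ‖symmKernel φ x t‖
        ≤ ∫ x, (t ^ 2)⁻¹ * ((‖φ x‖ + ‖φ (x + t)‖) + (‖φ x‖ + ‖φ (x - t)‖)) := by
          refine integral_mono (hx t).norm (((i1.add i2).add (i1.add i3)).const_mul _) fun x => ?_
          simp only [symmKernel]
          rw [norm_smul, Real.norm_of_nonneg (by positivity)]
          gcongr
          exact (norm_add_le _ _).trans (add_le_add (norm_sub_le _ _) (norm_sub_le _ _))
      _ = (t ^ 2)⁻¹ * (4 * ∫ x, ‖φ x‖) := by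
          rw [integral_const_mul, integral_add (f := fun x => ‖φ x‖ + ‖φ (x + t)‖)
            (g := fun x => ‖φ x‖ + ‖φ (x - t)‖) (i1.add i2) (i1.add i3), integral_add i1 i2,
            integral_add i1 i3, integral_add_right_eq_self (fun x => ‖φ x‖),
            integral_sub_right_eq_self (fun x => ‖φ x‖)]
          ring

theorem tendsto_setIntegral_Ioi_zero {f : ℝ → ℝ} (hf : IntegrableOn f (Set.Ioi 0)) :
    Tendsto (fun ε => ∫ t in Set.Ioi ε, f t) (𝓝[>] 0) (𝓝 (∫ t in Set.Ioi 0, f t)) := by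
  have h := (aecover_Ioi_of_Ioi (μ := (volume : Measure ℝ)) (l := 𝓝[>] (0 : ℝ)) (a := id) (A := 0)
    (tendsto_id.mono_left nhdsWithin_le_nhds)).integral_tendsto_of_countably_generated hf
  refine h.congr' ?_
  filter_upwards [self_mem_nhdsWithin] with ε hε
  rw [id, Measure.restrict_restrict_of_subset (Set.Ioi_subset_Ioi (le_of_lt hε))]

theorem integral_sub_add_sub {f g h : ℝ → ℝ} (hf : Integrable f) (hg : Integrable g)
    (hh : Integrable h) :
    ∫ x, ((f x - g x) + (f x - h x)) = ((∫ x, f x) - ∫ x, g x) + ((∫ x, f x) - ∫ x, h x) := by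
  rw [← integral_sub hf hg, ← integral_sub hf hh]
  exact integral_add (hf.sub hg) (hf.sub hh)

/-- The symmetrised second difference is a symmetric operator: by translation invariance it can be
moved from one factor of an integral to the other. -/
theorem integral_mul_symmKernel_comm {u φ : ℝ → ℝ} {M : ℝ} (hu : Continuous u)
    (hM : ∀ t, ‖u t‖ ≤ M) (hφ : Integrable φ) (t : ℝ) :
    ∫ x, u x * symmKernel φ x t = ∫ x, φ x * symmKernel u x t := by
  have i (s r : ℝ) : Integrable fun x => u (x + s) * φ (x + r) :=
    (hφ.comp_add_right r).bdd_mul (by fun_prop) (Eventually.of_forall fun x => hM _)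
  have e1 : ∀ x, u x * symmKernel φ x t = (t ^ 2)⁻¹ * ((u (x + 0) * φ (x + 0) -
      u (x + 0) * φ (x + t)) + (u (x + 0) * φ (x + 0) - u (x + 0) * φ (x + -t))) := by
    intro x; simp only [symmKernel, smul_eq_mul, add_zero, ← sub_eq_add_neg]; ring
  have e2 : ∀ x, φ x * symmKernel u x t = (t ^ 2)⁻¹ * ((u (x + 0) * φ (x + 0) -
      u (x + t) * φ (x + 0)) + (u (x + 0) * φ (x + 0) - u (x + -t) * φ (x + 0))) := by
    intro x; simp only [symmKernel, smul_eq_mul, add_zero, ← sub_eq_add_neg]; ring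
  have s1 : ∫ x, u (x + 0) * φ (x + t) = ∫ x, u (x + -t) * φ (x + 0) := by
    rw [← integral_add_right_eq_self (fun x => u (x + -t) * φ (x + 0)) t]
    simp
  have s2 : ∫ x, u (x + 0) * φ (x + -t) = ∫ x, u (x + t) * φ (x + 0) := by
    rw [← integral_add_right_eq_self (fun x => u (x + t) * φ (x + 0)) (-t)]
    simp
  simp only [e1, e2]
  rw [integral_const_mul, integral_const_mul,
    integral_sub_add_sub (i 0 0) (i 0 t) (i 0 (-t)), integral_sub_add_sub (i 0 0) (i t 0) (i (-t) 0),
    s1, s2]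
  ring

theorem integrable_mul_symmKernel_Ioi {u φ : ℝ → ℝ} {M ε : ℝ} (hu : Continuous u)
    (hM : ∀ t, ‖u t‖ ≤ M) (hφ : Integrable φ) (hε : 0 < ε) :
    Integrable (fun p : ℝ × ℝ => φ p.1 * symmKernel u p.1 p.2)
      (volume.prod (volume.restrict (Set.Ioi ε))) := by
  refine (hφ.norm.mul_prod ((integrableOn_inv_sq hε).mul_const (4 * M))).mono' ?_ ?_
  · exact hφ.aestronglyMeasurable.comp_fst.mul
      (measurable_uncurry_symmKernel hu).aestronglyMeasurable
  · refine Eventually.of_forall fun p => ?_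
    rw [norm_mul]
    gcongr
    exact norm_symmKernel_le hM _ _

/-- If the truncated singular integrals of a bounded continuous `u` converge almost everywhere and
are dominated by a function that is integrable against Schwartz functions, then their limit
represents the distributional square-root Laplacian of `u`: the operator is moved from the
Schwartz function to `u` for each fixed truncation, where Fubini's theorem applies. -/
theorem isDistribFracLaplacian_of_dominated {u g D : ℝ → ℝ} {M : ℝ} (hu : Continuous u)
    (hM : ∀ t, ‖u t‖ ≤ M) (hL2 : MemLp u 2)
    (hlim : ∀ᵐ x, Tendsto (fun ε => ∫ t in Set.Ioi ε, symmKernel u x t) (𝓝[>] 0)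
      (𝓝 (Real.pi * g x)))
    (hD : ∀ᵐ x, ∀ ε, 0 < ε → |∫ t in Set.Ioi ε, symmKernel u x t| ≤ D x)
    (hDφ : ∀ φ : 𝓢(ℝ, ℝ), Integrable fun x => D x * φ x) :
    IsDistribFracLaplacian (1 / 2) u g := by
  refine ⟨hL2, fun φ => ?_⟩
  have hφ : Integrable φ := φ.integrable
  have hK := integrable_symmKernel_schwartz φ
  set P : ℝ → ℝ := fun x => ∫ t in Set.Ioi 0, symmKernel φ x t with hP
  have hPi : Integrable P := hK.integral_prod_left
  obtain ⟨C, hC⟩ : ∃ C, ∀ x, ‖φ x‖ ≤ C := by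
    obtain ⟨C, -, hC⟩ := φ.decay 0 0
    exact ⟨C, fun x => by simpa using hC x⟩
  have hφP : fracLaplacian (1 / 2) φ =ᵐ[volume] fun x => Real.pi⁻¹ * P x := by
    filter_upwards [hK.prod_right_ae] with x hx
    exact (pvExists_and_fracLaplacian_eq φ.continuous hC (tendsto_setIntegral_Ioi_zero hx)).2
  have huP : (fun x => u x * fracLaplacian (1 / 2) φ x) =ᵐ[volume]
      fun x => Real.pi⁻¹ * (u x * P x) := by
    filter_upwards [hφP] with x hx
    rw [hx]; ring
  have huPi : Integrable fun x => u x * P x :=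
    hPi.bdd_mul hu.aestronglyMeasurable (Eventually.of_forall hM)
  have huK : Integrable (fun p : ℝ × ℝ => u p.1 * symmKernel φ p.1 p.2)
      (volume.prod (volume.restrict (Set.Ioi 0))) :=
    hK.bdd_mul (hu.comp continuous_fst).aestronglyMeasurable (Eventually.of_forall fun p => hM _)
  -- The truncated pairings, computed by Fubini's theorem in the order that puts the kernel on `u`.
  have hswap : ∀ ε : ℝ, 0 < ε → ∫ t in Set.Ioi ε, ∫ x, u x * symmKernel φ x t =
      ∫ x, φ x * ∫ t in Set.Ioi ε, symmKernel u x t := by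
    intro ε hε
    simp only [integral_mul_symmKernel_comm hu hM hφ, ← integral_const_mul]
    exact (integral_integral_swap (integrable_mul_symmKernel_Ioi hu hM hφ hε)).symm
  have hmeas : ∀ ε : ℝ, 0 < ε →
      AEStronglyMeasurable (fun x => φ x * ∫ t in Set.Ioi ε, symmKernel u x t) := by
    intro ε hε
    have := (integrable_mul_symmKernel_Ioi hu hM hφ hε).integral_prod_left.aestronglyMeasurable
    simpa only [integral_const_mul] using this
  have hbound : ∀ ε : ℝ, 0 < ε →
      ∀ᵐ x, ‖φ x * ∫ t in Set.Ioi ε, symmKernel u x t‖ ≤ ‖D x * φ x‖ := by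
    intro ε hε
    filter_upwards [hD] with x hx
    rw [norm_mul, norm_mul, mul_comm]
    gcongr
    exact (hx ε hε).trans (le_abs_self _)
  have hlim' : ∀ᵐ x, Tendsto (fun ε => φ x * ∫ t in Set.Ioi ε, symmKernel u x t) (𝓝[>] 0)
      (𝓝 (φ x * (Real.pi * g x))) := by
    filter_upwards [hlim] with x hx
    exact hx.const_mul _
  have hpos : ∀ᶠ ε : ℝ in 𝓝[>] 0, 0 < ε := self_mem_nhdsWithin
  have h1 : Tendsto (fun ε => ∫ x, φ x * ∫ t in Set.Ioi ε, symmKernel u x t) (𝓝[>] 0)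
      (𝓝 (∫ x, φ x * (Real.pi * g x))) :=
    tendsto_integral_filter_of_dominated_convergence (fun x => ‖D x * φ x‖)
      (hpos.mono hmeas) (hpos.mono hbound) (hDφ φ).norm hlim'
  have h2 := tendsto_setIntegral_Ioi_zero huK.integral_prod_right
  have h3 : ∫ x, φ x * (Real.pi * g x) = ∫ x, u x * P x := by
    refine (tendsto_nhds_unique (h2.congr' (hpos.mono hswap)) h1).symm.trans ?_
    simp only [hP, ← integral_const_mul]
    exact (integral_integral_swap huK).symm
  have hgi : Integrable fun x => φ x * (Real.pi * g x) := by
    have hm : AEStronglyMeasurable (fun x => φ x * (Real.pi * g x)) := by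
      have hs : Tendsto (fun n : ℕ => 1 / ((n : ℝ) + 1)) atTop (𝓝[>] 0) :=
        tendsto_nhdsWithin_iff.2 ⟨tendsto_one_div_add_atTop_nhds_zero_nat,
          Eventually.of_forall fun n => Set.mem_Ioi.2 Nat.one_div_pos_of_nat⟩
      refine aestronglyMeasurable_of_tendsto_ae atTop
        (fun n : ℕ => hmeas (1 / ((n : ℝ) + 1)) Nat.one_div_pos_of_nat) ?_
      filter_upwards [hlim'] with x hx
      exact hx.comp hs
    refine (hDφ φ).norm.mono' hm ?_
    filter_upwards [hlim', hD] with x hx hx'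
    refine le_of_tendsto hx.norm (hpos.mono fun ε hε => ?_)
    rw [norm_mul, norm_mul, mul_comm]
    gcongr
    exact (hx' ε hε).trans (le_abs_self _)
  have e : ∀ x, g x * φ x = Real.pi⁻¹ * (φ x * (Real.pi * g x)) := by
    intro x
    have := Real.pi_ne_zero
    field_simp
  refine ⟨(huPi.const_mul _).congr huP.symm, ?_, ?_⟩
  · simp only [e]
    exact hgi.const_mul _
  · rw [integral_congr_ae huP]
    simp only [e]
    rw [integral_const_mul, integral_const_mul, h3]

/-! ### The inverse Joukowsky map on the upper half-plane and its boundary values -/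

/-- A square root of `-i (z - c)`. On the closed upper half-plane the radicand has nonnegative real
part, so the principal branch is continuous there, including at the branch point `c`. -/
noncomputable def rotSqrt (c : ℝ) (z : ℂ) : ℂ :=
  (-Complex.I * (z - c)).sqrt

theorem rotSqrt_sq (c : ℝ) (z : ℂ) : rotSqrt c z ^ 2 = -Complex.I * (z - c) := by
  have := Complex.cpow_nat_inv_pow (-Complex.I * (z - c)) two_ne_zero
  rwa [Nat.cast_ofNat] at this

theorem rotSqrt_re_nonneg (c : ℝ) (z : ℂ) : 0 ≤ (rotSqrt c z).re := by
  rw [rotSqrt, Complex.sqrt, Complex.cpow_inv_two_re]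
  positivity

theorem rotSqrt_sq_re (c : ℝ) (z : ℂ) :
    (rotSqrt c z).re ^ 2 - (rotSqrt c z).im ^ 2 = z.im := by
  have := congrArg Complex.re (rotSqrt_sq c z)
  simp [pow_two] at this
  linarith

theorem rotSqrt_sq_im (c : ℝ) (z : ℂ) :
    2 * ((rotSqrt c z).re * (rotSqrt c z).im) = c - z.re := by
  have := congrArg Complex.im (rotSqrt_sq c z)
  simp [pow_two] at this
  linarith

theorem abs_rotSqrt_im_le (c : ℝ) {z : ℂ} (hz : 0 ≤ z.im) :
    |(rotSqrt c z).im| ≤ (rotSqrt c z).re := by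
  refine abs_le_of_sq_le_sq ?_ (rotSqrt_re_nonneg c z)
  linarith [rotSqrt_sq_re c z]

theorem norm_rotSqrt_sq (c : ℝ) (z : ℂ) : ‖rotSqrt c z‖ ^ 2 = ‖z - c‖ := by
  rw [← norm_pow, rotSqrt_sq, norm_mul, norm_neg, Complex.norm_I, one_mul]

theorem norm_rotSqrt (c : ℝ) (z : ℂ) : ‖rotSqrt c z‖ = √‖z - c‖ := by
  rw [← norm_rotSqrt_sq, Real.sqrt_sq (norm_nonneg _)]

/-- Two values of the square roots on the closed upper half-plane lie in the sector
`|arg| ≤ π / 4`, so they make an angle of at most `π / 2`. -/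
theorem rotSqrt_re_mul_re_sub_abs_nonneg (c d : ℝ) {z w : ℂ} (hz : 0 ≤ z.im) (hw : 0 ≤ w.im) :
    0 ≤ (rotSqrt c z).re * (rotSqrt d w).re - |(rotSqrt c z).im * (rotSqrt d w).im| := by
  have h1 := abs_rotSqrt_im_le c hz
  have h2 := abs_rotSqrt_im_le d hw
  rw [abs_mul, sub_nonneg]
  exact mul_le_mul h1 h2 (abs_nonneg _) (rotSqrt_re_nonneg c z)

theorem norm_sq_add_norm_sq_le_norm_add_sq {s t : ℂ} (h : 0 ≤ s.re * t.re + s.im * t.im) :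
    ‖s‖ ^ 2 + ‖t‖ ^ 2 ≤ ‖s + t‖ ^ 2 := by
  simp only [Complex.sq_norm, Complex.normSq_apply, Complex.add_re, Complex.add_im]
  nlinarith

theorem norm_sub_le_norm_add {s t : ℂ} (h : 0 ≤ s.re * t.re + s.im * t.im) :
    ‖s - t‖ ≤ ‖s + t‖ := by
  refine le_of_sq_le_sq ?_ (norm_nonneg _)
  simp only [Complex.sq_norm, Complex.normSq_apply, Complex.add_re, Complex.add_im,
    Complex.sub_re, Complex.sub_im]
  nlinarith

theorem rotSqrt_real_inner_nonneg (c d : ℝ) {z w : ℂ} (hz : 0 ≤ z.im) (hw : 0 ≤ w.im) :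
    0 ≤ (rotSqrt c z).re * (rotSqrt d w).re + (rotSqrt c z).im * (rotSqrt d w).im := by
  linarith [rotSqrt_re_mul_re_sub_abs_nonneg c d hz hw, neg_abs_le ((rotSqrt c z).im * (rotSqrt d w).im)]

theorem norm_rotSqrt_sub_mul_add (c : ℝ) (z w : ℂ) :
    ‖rotSqrt c z - rotSqrt c w‖ * ‖rotSqrt c z + rotSqrt c w‖ = ‖z - w‖ := by
  rw [← norm_mul]
  have : (rotSqrt c z - rotSqrt c w) * (rotSqrt c z + rotSqrt c w) = -Complex.I * (z - w) := by
    linear_combination rotSqrt_sq c z - rotSqrt_sq c w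
  rw [this, norm_mul, norm_neg, Complex.norm_I, one_mul]

theorem norm_rotSqrt_sub_mul_le (c : ℝ) {z w : ℂ} (hz : 0 ≤ z.im) (hw : 0 ≤ w.im) :
    ‖rotSqrt c z - rotSqrt c w‖ * ‖rotSqrt c w‖ ≤ ‖z - w‖ := by
  rw [← norm_rotSqrt_sub_mul_add c z w]
  gcongr
  refine le_of_sq_le_sq ?_ (norm_nonneg _)
  have := norm_sq_add_norm_sq_le_norm_add_sq (rotSqrt_real_inner_nonneg c c hz hw)
  linarith [sq_nonneg ‖rotSqrt c z‖]

theorem norm_rotSqrt_sub_le_sqrt (c : ℝ) {z w : ℂ} (hz : 0 ≤ z.im) (hw : 0 ≤ w.im) :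
    ‖rotSqrt c z - rotSqrt c w‖ ≤ √‖z - w‖ := by
  refine Real.le_sqrt_of_sq_le ?_
  rw [← norm_rotSqrt_sub_mul_add c z w, pow_two]
  gcongr
  exact norm_sub_le_norm_add (rotSqrt_real_inner_nonneg c c hz hw)

theorem continuousOn_rotSqrt (c : ℝ) : ContinuousOn (rotSqrt c) {z | 0 ≤ z.im} := by
  intro w hw
  rw [ContinuousWithinAt, tendsto_iff_norm_sub_tendsto_zero]
  have h : Tendsto (fun z : ℂ => √‖z - w‖) (𝓝[{z | 0 ≤ z.im}] w) (𝓝 0) := by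
    have : Continuous fun z : ℂ => √‖z - w‖ := by fun_prop
    simpa using this.continuousWithinAt (s := {z | 0 ≤ z.im}) (x := w) |>.tendsto
  refine squeeze_zero' (Eventually.of_forall fun z => norm_nonneg _) ?_ h
  filter_upwards [self_mem_nhdsWithin] with z hz
  exact norm_rotSqrt_sub_le_sqrt c hz hw

theorem rotSqrt_ne_zero {c : ℝ} {z : ℂ} (hzc : z ≠ c) : rotSqrt c z ≠ 0 := by
  intro h
  have := rotSqrt_sq c z
  rw [h, zero_pow two_ne_zero] at this
  exact mul_ne_zero (neg_ne_zero.2 Complex.I_ne_zero) (sub_ne_zero.2 hzc) this.symm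

theorem hasDerivAt_rotSqrt {c : ℝ} {z : ℂ} (hz : 0 ≤ z.im) (hzc : z ≠ c) :
    HasDerivAt (rotSqrt c) (-Complex.I / (2 * rotSqrt c z)) z := by
  have hp : -Complex.I * (z - c) ≠ 0 := mul_ne_zero (by simp) (sub_ne_zero.2 hzc)
  have hs : -Complex.I * (z - c) ∈ Complex.slitPlane := by
    rw [Complex.mem_slitPlane_iff]
    rcases hz.lt_or_eq with h | h
    · left; simpa using h
    · right
      have : c ≠ z.re := fun hc => hzc (Complex.ext (by simpa using hc.symm) (by simpa using h.symm))
      simpa [sub_eq_zero, eq_comm] using this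
  have hd : HasDerivAt (fun z : ℂ => -Complex.I * (z - c)) (-Complex.I) z := by
    simpa using ((hasDerivAt_id z).sub_const (c : ℂ)).const_mul (-Complex.I)
  have h := hd.cpow_const (c := (2⁻¹ : ℂ)) hs
  refine h.congr_deriv ?_
  have hr := rotSqrt_ne_zero hzc
  rw [Complex.cpow_sub _ _ hp, Complex.cpow_one]
  change 2⁻¹ * (rotSqrt c z / _) * -Complex.I = _
  rw [← rotSqrt_sq]
  field_simp

/-- A branch of `√(1 - z²)` on the closed upper half-plane. -/
noncomputable def upperSqrt (z : ℂ) : ℂ := rotSqrt 1 z * rotSqrt (-1) z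

/-- The inverse Joukowsky map `z - √(z² - 1)` on the closed upper half-plane, written as a square
so that its size can be read off from that of the two square roots. -/
noncomputable def invJoukowsky (z : ℂ) : ℂ :=
  Complex.I / 2 * (rotSqrt 1 z - rotSqrt (-1) z) ^ 2

theorem invJoukowsky_eq (z : ℂ) : invJoukowsky z = z - Complex.I * upperSqrt z := by
  have h1 := rotSqrt_sq 1 z
  have h2 := rotSqrt_sq (-1) z
  push_cast at h1 h2
  have h3 : Complex.I ^ 2 = -1 := Complex.I_sq
  rw [invJoukowsky, upperSqrt]
  linear_combination Complex.I / 2 * (h1 + h2) - z * h3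

theorem upperSqrt_sq (z : ℂ) : upperSqrt z ^ 2 = 1 - z ^ 2 := by
  have h1 := rotSqrt_sq 1 z
  have h2 := rotSqrt_sq (-1) z
  push_cast at h1 h2
  have h3 : Complex.I ^ 2 = -1 := Complex.I_sq
  rw [upperSqrt, mul_pow, h1, h2]
  linear_combination (z ^ 2 - 1) * h3

theorem upperSqrt_re_nonneg {z : ℂ} (hz : 0 ≤ z.im) : 0 ≤ (upperSqrt z).re := by
  rw [upperSqrt, Complex.mul_re]
  linarith [rotSqrt_re_mul_re_sub_abs_nonneg 1 (-1) hz hz,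
    le_abs_self ((rotSqrt 1 z).im * (rotSqrt (-1) z).im)]

theorem norm_rotSqrt_sub_sq (z : ℂ) :
    ‖rotSqrt 1 z - rotSqrt (-1) z‖ ^ 2 = 2 * ‖invJoukowsky z‖ := by
  rw [invJoukowsky, norm_mul, norm_pow, norm_div, Complex.norm_I, Complex.norm_ofNat]
  ring

theorem norm_rotSqrt_sub_mul_add_eq_two (z : ℂ) :
    ‖rotSqrt 1 z - rotSqrt (-1) z‖ * ‖rotSqrt 1 z + rotSqrt (-1) z‖ = 2 := by
  rw [← norm_mul]
  have : (rotSqrt 1 z - rotSqrt (-1) z) * (rotSqrt 1 z + rotSqrt (-1) z) = 2 * Complex.I := by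
    have h1 := rotSqrt_sq 1 z
    have h2 := rotSqrt_sq (-1) z
    push_cast at h1 h2
    linear_combination h1 - h2
  rw [this, norm_mul, Complex.norm_I, Complex.norm_ofNat, mul_one]

theorem norm_invJoukowsky_le_one {z : ℂ} (hz : 0 ≤ z.im) : ‖invJoukowsky z‖ ≤ 1 := by
  have h1 := norm_rotSqrt_sub_sq z
  have h2 := norm_rotSqrt_sub_mul_add_eq_two z
  have h3 := mul_le_mul_of_nonneg_left
    (norm_sub_le_norm_add (rotSqrt_real_inner_nonneg 1 (-1) hz hz))
    (norm_nonneg (rotSqrt 1 z - rotSqrt (-1) z))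
  nlinarith

theorem norm_invJoukowsky_mul_norm_le_one {z : ℂ} (hz : 0 ≤ z.im) :
    ‖invJoukowsky z‖ * ‖z‖ ≤ 1 := by
  have h1 := norm_rotSqrt_sub_sq z
  have h2 := norm_rotSqrt_sub_mul_add_eq_two z
  have h3 := norm_sq_add_norm_sq_le_norm_add_sq (rotSqrt_real_inner_nonneg 1 (-1) hz hz)
  rw [norm_rotSqrt_sq, norm_rotSqrt_sq] at h3
  have h4 : 2 * ‖z‖ ≤ ‖z - (1 : ℝ)‖ + ‖z - (-1 : ℝ)‖ := by
    have := norm_add_le (z - (1 : ℝ)) (z - (-1 : ℝ))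
    rw [show z - (1 : ℝ) + (z - (-1 : ℝ)) = 2 * z by push_cast; ring, norm_mul,
      Complex.norm_ofNat] at this
    exact this
  have h5 : 2 * ‖invJoukowsky z‖ * ‖rotSqrt 1 z + rotSqrt (-1) z‖ ^ 2 = 4 := by
    rw [← h1, ← mul_pow, h2]; norm_num
  have h6 := mul_le_mul_of_nonneg_left (h4.trans h3) (norm_nonneg (invJoukowsky z))
  linarith

/-- A Lipschitz bound at a boundary point which degenerates only like the inverse square root of
the distance to the branch points. -/
theorem norm_invJoukowsky_sub_le {z w : ℂ} (hz : 0 ≤ z.im) (hw : 0 ≤ w.im) (h1 : w ≠ (1 : ℝ))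
    (h2 : w ≠ (-1 : ℝ)) :
    ‖invJoukowsky z - invJoukowsky w‖ ≤
      2 * ((√‖w - (1 : ℝ)‖)⁻¹ + (√‖w - (-1 : ℝ)‖)⁻¹) * ‖z - w‖ := by
  have e : invJoukowsky z - invJoukowsky w = Complex.I / 2 *
      (((rotSqrt 1 z - rotSqrt 1 w) - (rotSqrt (-1) z - rotSqrt (-1) w)) *
      ((rotSqrt 1 z - rotSqrt (-1) z) + (rotSqrt 1 w - rotSqrt (-1) w))) := by
    rw [invJoukowsky, invJoukowsky]; ring
  have b : ∀ v : ℂ, 0 ≤ v.im → ‖rotSqrt 1 v - rotSqrt (-1) v‖ ≤ 2 := by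
    intro v hv
    have := norm_rotSqrt_sub_sq v
    nlinarith [norm_invJoukowsky_le_one hv]
  have d : ∀ c : ℝ, w ≠ c → ‖rotSqrt c z - rotSqrt c w‖ ≤ (√‖w - c‖)⁻¹ * ‖z - w‖ := by
    intro c hc
    have h0 : 0 < ‖rotSqrt c w‖ := norm_pos_iff.2 (rotSqrt_ne_zero hc)
    rw [← norm_rotSqrt, inv_mul_eq_div, le_div_iff₀ h0]
    exact norm_rotSqrt_sub_mul_le c hz hw
  rw [e, norm_mul, norm_mul, norm_div, Complex.norm_I, Complex.norm_ofNat]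
  calc _ ≤ 1 / 2 * (((√‖w - (1 : ℝ)‖)⁻¹ * ‖z - w‖ + (√‖w - (-1 : ℝ)‖)⁻¹ * ‖z - w‖) * (2 + 2)) := by
        gcongr
        · exact (norm_sub_le _ _).trans (add_le_add (d 1 h1) (d (-1) h2))
        · exact (norm_add_le _ _).trans (add_le_add (b z hz) (b w hw))
    _ = _ := by ring

theorem continuousOn_invJoukowsky : ContinuousOn invJoukowsky {z | 0 ≤ z.im} :=
  continuousOn_const.mul (((continuousOn_rotSqrt 1).sub (continuousOn_rotSqrt (-1))).pow 2)

theorem hasDerivAt_invJoukowsky {z : ℂ} (hz : 0 ≤ z.im) (h1 : z ≠ (1 : ℝ)) (h2 : z ≠ (-1 : ℝ)) :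
    HasDerivAt invJoukowsky (Complex.I * invJoukowsky z / upperSqrt z) z := by
  have h := ((((hasDerivAt_rotSqrt hz h1).sub (hasDerivAt_rotSqrt hz h2)).pow 2).const_mul
    (Complex.I / 2))
  refine h.congr_deriv ?_
  have n1 := rotSqrt_ne_zero h1
  have n2 := rotSqrt_ne_zero h2
  simp only [invJoukowsky, upperSqrt, Pi.sub_apply]
  field_simp
  push_cast
  ring

theorem upperSqrt_ofReal_of_abs_le {x : ℝ} (hx : |x| ≤ 1) :
    upperSqrt x = (√(1 - x ^ 2) : ℝ) := by
  have h0 : 0 ≤ 1 - x ^ 2 := sub_nonneg.2 ((sq_le_one_iff_abs_le_one x).2 hx)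
  have h := upperSqrt_sq x
  have h' : upperSqrt x ^ 2 = ((√(1 - x ^ 2) : ℝ) : ℂ) ^ 2 := by
    rw [h, ← Complex.ofReal_pow (√_), Real.sq_sqrt h0]; push_cast; ring
  rcases sq_eq_sq_iff_eq_or_eq_neg.1 h' with h | h
  · exact h
  · have hre := upperSqrt_re_nonneg (z := x) (by simp)
    rw [h, Complex.neg_re, Complex.ofReal_re] at hre
    have : √(1 - x ^ 2) = 0 := le_antisymm (by linarith) (Real.sqrt_nonneg _)
    rw [h, this]; simp

theorem upperSqrt_ofReal_of_one_lt {x : ℝ} (hx : 1 < |x|) :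
    upperSqrt x = -Complex.I * (Real.sign x * √(x ^ 2 - 1) : ℝ) := by
  have h0 : 0 < x ^ 2 - 1 := sub_pos.2 ((one_lt_sq_iff_one_lt_abs x).2 hx)
  have hs : 0 < √(x ^ 2 - 1) := Real.sqrt_pos.2 h0
  have hsgn : Real.sign x ^ 2 = 1 := by
    rcases lt_abs.1 hx with h | h
    · rw [Real.sign_of_pos (by linarith)]; norm_num
    · rw [Real.sign_of_neg (by linarith)]; norm_num
  have h' : upperSqrt x ^ 2 = (-Complex.I * (Real.sign x * √(x ^ 2 - 1) : ℝ)) ^ 2 := by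
    rw [upperSqrt_sq, mul_pow, neg_sq, Complex.I_sq, ← Complex.ofReal_pow (_ * _), mul_pow, hsgn,
      Real.sq_sqrt h0.le]
    push_cast; ring
  -- The sign of the imaginary part decides between the two square roots.
  have him : (upperSqrt x).im * Real.sign x ≤ 0 := by
    have i1 := rotSqrt_sq_im 1 x
    have i2 := rotSqrt_sq_im (-1) x
    have r1 := rotSqrt_re_nonneg 1 x
    have r2 := rotSqrt_re_nonneg (-1) x
    rw [Complex.ofReal_re] at i1 i2
    rw [upperSqrt, Complex.mul_im]
    rcases lt_abs.1 hx with h | h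
    · have m1 : (rotSqrt 1 x).im ≤ 0 := by by_contra!; nlinarith
      have m2 : (rotSqrt (-1) x).im ≤ 0 := by by_contra!; nlinarith
      rw [Real.sign_of_pos (by linarith)]
      nlinarith
    · have m1 : 0 ≤ (rotSqrt 1 x).im := by by_contra!; nlinarith
      have m2 : 0 ≤ (rotSqrt (-1) x).im := by by_contra!; nlinarith
      rw [Real.sign_of_neg (by linarith)]
      nlinarith
  rcases sq_eq_sq_iff_eq_or_eq_neg.1 h' with h | h
  · exact h
  · exfalso
    rw [h] at him
    simp only [neg_mul, neg_neg, Complex.mul_im, Complex.I_re, Complex.I_im,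
      Complex.ofReal_re, Complex.ofReal_im] at him
    nlinarith

theorem invJoukowsky_of_one_lt {x : ℝ} (hx : 1 < |x|) :
    invJoukowsky x = (x - Real.sign x * √(x ^ 2 - 1) : ℝ) := by
  rw [invJoukowsky_eq, upperSqrt_ofReal_of_one_lt hx]
  push_cast
  linear_combination (Real.sign x * √(x ^ 2 - 1) : ℂ) * Complex.I_sq

theorem invJoukowsky_pow_of_abs_le {x : ℝ} (hx : |x| ≤ 1) (n : ℕ) :
    invJoukowsky x ^ n =
      Real.cos (n * Real.arccos x) - Real.sin (n * Real.arccos x) * Complex.I := by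
  have hc : Real.cos (Real.arccos x) = x := Real.cos_arccos (abs_le.1 hx).1 (abs_le.1 hx).2
  have h : invJoukowsky x = Complex.exp ((-Real.arccos x : ℝ) * Complex.I) := by
    rw [invJoukowsky_eq, upperSqrt_ofReal_of_abs_le hx, Complex.exp_mul_I, ← Complex.ofReal_cos,
      ← Complex.ofReal_sin, Real.cos_neg, Real.sin_neg, hc, Real.sin_arccos]
    push_cast; ring
  rw [h, ← Complex.exp_nat_mul, ← mul_assoc, ← Complex.ofReal_natCast, ← Complex.ofReal_mul,
    Complex.exp_mul_I, ← Complex.ofReal_cos, ← Complex.ofReal_sin, mul_neg, Real.cos_neg,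
    Real.sin_neg]
  push_cast; ring

/-- The real part of the boundary values of `(z - √(z² - 1))ⁿ` is `T̃ₙ`. -/
theorem invJoukowsky_pow_re (n : ℕ) (x : ℝ) : (invJoukowsky x ^ n).re = extT n x := by
  rw [extT]
  split_ifs with hx
  · have hc : Real.cos (Real.arccos x) = x := Real.cos_arccos (abs_le.1 hx).1 (abs_le.1 hx).2
    have := Polynomial.Chebyshev.T_real_cos (Real.arccos x) n
    rw [hc, Int.cast_natCast] at this
    rw [invJoukowsky_pow_of_abs_le hx, this, Complex.sub_re, Complex.ofReal_re,
      Complex.re_ofReal_mul, Complex.I_re, mul_zero, sub_zero]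
  · rw [invJoukowsky_of_one_lt (not_le.1 hx), ← Complex.ofReal_pow, Complex.ofReal_re]

theorem invJoukowsky_pow_of_one_lt (n : ℕ) {x : ℝ} (hx : 1 < |x|) :
    invJoukowsky x ^ n = extT n x := by
  rw [extT, if_neg (not_le.2 hx), invJoukowsky_of_one_lt hx, ← Complex.ofReal_pow]

/-- The imaginary part of the boundary values of `(z - √(z² - 1))ⁿ⁺¹` is `-Wₙ`. -/
theorem invJoukowsky_pow_im (n : ℕ) (x : ℝ) : (invJoukowsky x ^ (n + 1)).im = -wU n x := by
  rw [wU]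
  rcases le_or_gt |x| 1 with hx | hx
  · have hc : Real.cos (Real.arccos x) = x := Real.cos_arccos (abs_le.1 hx).1 (abs_le.1 hx).2
    have := Polynomial.Chebyshev.U_real_cos (Real.arccos x) n
    rw [hc, Int.cast_natCast, Real.sin_arccos] at this
    have h2 : (invJoukowsky x ^ (n + 1)).im =
        -(√(1 - x ^ 2) * (Polynomial.Chebyshev.U ℝ n).eval x) := by
      rw [invJoukowsky_pow_of_abs_le hx, mul_comm √_, this, Complex.sub_im, Complex.ofReal_im,
        Complex.im_ofReal_mul, Complex.I_im, mul_one, zero_sub, Nat.cast_succ]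
    split_ifs with h1
    · exact h2
    · have : x ^ 2 = 1 := by rw [← sq_abs, le_antisymm hx (not_lt.1 h1), one_pow]
      rw [h2, this]; simp
  · rw [invJoukowsky_pow_of_one_lt _ hx, if_neg (not_lt.2 hx.le)]
    simp

theorem extU_of_abs_le {x : ℝ} (hx : |x| ≤ 1) (n : ℕ) :
    extU n x = (Polynomial.Chebyshev.U ℝ n).eval x := by
  induction n using Nat.twoStepInduction with
  | zero => simp [extU, extT, extUNegTwo, hx]
  | one => simp [extU, extT, extUNegOne, hx]
  | more n h1 _ =>
    rw [extU, h1, extT, if_pos hx]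
    have := congrArg (Polynomial.eval x) (Polynomial.Chebyshev.U_eq_two_mul_T_add_U ℝ n)
    simp only [Polynomial.eval_add, Polynomial.eval_mul, Polynomial.eval_ofNat] at this
    push_cast
    rw [this]

/-- Outside `[-1, 1]` the recursion for `Ũₙ` telescopes, since `w⁻¹ - w = 2 sgn(x) √(x² - 1)` for
`w = x - sgn(x) √(x² - 1)`. -/
theorem extU_of_one_lt {x : ℝ} (hx : 1 < |x|) (n : ℕ) :
    extU n x = -(Real.sign x * extT (n + 1) x / √(x ^ 2 - 1)) := by
  have h0 : 0 < x ^ 2 - 1 := sub_pos.2 ((one_lt_sq_iff_one_lt_abs x).2 hx)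
  have hs : √(x ^ 2 - 1) ≠ 0 := (Real.sqrt_pos.2 h0).ne'
  have hsq : √(x ^ 2 - 1) ^ 2 = x ^ 2 - 1 := Real.sq_sqrt h0.le
  have hsgn : Real.sign x ^ 2 = 1 := by
    rcases lt_abs.1 hx with h | h
    · rw [Real.sign_of_pos (by linarith)]; norm_num
    · rw [Real.sign_of_neg (by linarith)]; norm_num
  have habs : |x| = Real.sign x * x := by
    rcases lt_abs.1 hx with h | h
    · rw [Real.sign_of_pos (by linarith), abs_of_pos (by linarith), one_mul]
    · rw [Real.sign_of_neg (by linarith), abs_of_neg (by linarith), neg_one_mul]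
  have hT (k : ℕ) : extT k x = (x - Real.sign x * √(x ^ 2 - 1)) ^ k := by
    rw [extT, if_neg (not_le.2 hx)]
  induction n using Nat.twoStepInduction with
  | zero =>
    rw [extU, extUNegTwo, if_neg (not_le.2 hx), hT, hT, habs]
    field_simp
    linear_combination (-√(x ^ 2 - 1)) * hsgn
  | one =>
    rw [extU, extUNegOne, if_neg (not_le.2 hx), hT, hT]
    field_simp
    linear_combination -Real.sign x * hsq +
      (-2 * x * √(x ^ 2 - 1) + Real.sign x * √(x ^ 2 - 1) ^ 2) * hsgn
  | more n h1 _ =>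
    rw [extU, h1, hT, hT, hT]
    field_simp
    linear_combination (x - Real.sign x * √(x ^ 2 - 1)) ^ (n + 1) * (-Real.sign x * hsq +
      (-2 * x * √(x ^ 2 - 1) + Real.sign x * √(x ^ 2 - 1) ^ 2) * hsgn)

/-! ### The square-root Laplacian of boundary values of holomorphic functions -/

theorem symmKernel_re {F : ℂ → ℂ} (x t : ℝ) :
    symmKernel (fun y : ℝ => (F y).re) x t = (symmKernel (fun y : ℝ => F y) x t).re := by
  simp only [symmKernel, Complex.smul_re, Complex.add_re, Complex.sub_re, smul_eq_mul]

/-- The truncated singular integrals of the real part of the boundary values of a bounded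
holomorphic function on the upper half-plane are averages of its difference quotients. -/
theorem integral_Ioi_symmKernel_re {F : ℂ → ℂ} {M : ℝ}
    (hc : ContinuousOn F {z | 0 ≤ z.im}) (hd : DifferentiableOn ℂ F {z | 0 < z.im})
    (hM : ∀ z : ℂ, 0 ≤ z.im → ‖F z‖ ≤ M) (x : ℝ) {ε : ℝ} (hε : 0 < ε) :
    ∫ t in Set.Ioi ε, symmKernel (fun y : ℝ => (F y).re) x t = (semicircleSlope F x ε).im := by
  have hcr : Continuous fun y : ℝ => F y :=
    hc.comp_continuous Complex.continuous_ofReal fun y => by simp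
  have h := Complex.reCLM.integral_comp_comm
    (integrableOn_symmKernel hcr (fun t => hM t (by simp)) x hε)
  simp only [Complex.reCLM_apply] at h
  simp only [symmKernel_re]
  rw [h, integral_Ioi_symmKernel_eq_semicircleSlope hc hd hM x hε]
  simp

/-- The square-root Laplacian of `Re F` is `Im F'`: the Dirichlet-to-Neumann map of the upper
half-plane, applied to boundary values of a bounded holomorphic function. -/
theorem tendsto_integral_Ioi_symmKernel_re {F : ℂ → ℂ} {M x : ℝ} {F' : ℂ}
    (hc : ContinuousOn F {z | 0 ≤ z.im}) (hd : DifferentiableOn ℂ F {z | 0 < z.im})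
    (hM : ∀ z : ℂ, 0 ≤ z.im → ‖F z‖ ≤ M) (hF : HasDerivWithinAt F F' {z | 0 ≤ z.im} x) :
    Tendsto (fun ε => ∫ t in Set.Ioi ε, symmKernel (fun y : ℝ => (F y).re) x t) (𝓝[>] 0)
      (𝓝 (Real.pi * F'.im)) := by
  have h := (Complex.continuous_im.tendsto _).comp (tendsto_semicircleSlope_zero hc hF)
  rw [Complex.im_mul_ofReal, mul_comm] at h
  refine h.congr' ?_
  filter_upwards [self_mem_nhdsWithin] with ε hε
  exact (integral_Ioi_symmKernel_re hc hd hM x hε).symm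

theorem integrableOn_inv_sqrt_abs :
    IntegrableOn (fun x : ℝ => (√|x|)⁻¹) (Set.Icc (-1) 1) := by
  have h1 : IntervalIntegrable (fun x : ℝ => (√|x|)⁻¹) volume 0 1 := by
    refine (intervalIntegral.intervalIntegrable_rpow' (r := -(1 / 2)) (by norm_num)).congr ?_
    intro x hx
    rw [Set.uIoc_of_le zero_le_one] at hx
    simp only
    rw [Real.rpow_neg hx.1.le, ← Real.sqrt_eq_rpow, abs_of_pos hx.1]
  have h2 : IntervalIntegrable (fun x : ℝ => (√|x|)⁻¹) volume (-1) 0 := by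
    have := (IntervalIntegrable.iff_comp_neg (by simp)).1 h1
    simpa using this.symm
  rw [← intervalIntegrable_iff_integrableOn_Icc_of_le (by norm_num)]
  exact h2.trans h1

theorem integrable_inv_sqrt_abs_sub_mul (c : ℝ) (φ : 𝓢(ℝ, ℝ)) :
    Integrable fun x => (√|x - c|)⁻¹ * φ x := by
  obtain ⟨C, hC0, hC⟩ := SchwartzMap.exists_abs_le_inv_one_add_sq φ
  have hC' (x : ℝ) : |φ x| ≤ C := by
    refine (hC x).trans (mul_le_of_le_one_right hC0 (inv_le_one_of_one_le₀ ?_))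
    nlinarith [sq_nonneg x]
  have h1 := ((integrable_indicator_iff measurableSet_Icc).2
    integrableOn_inv_sqrt_abs).comp_sub_right c
  refine ((h1.mul_const C).add φ.integrable.norm).mono' ?_ (Eventually.of_forall fun x => ?_)
  · exact (by fun_prop : Measurable fun x : ℝ => (√|x - c|)⁻¹).aestronglyMeasurable.mul
      φ.continuous.aestronglyMeasurable
  · rw [Pi.add_apply, norm_mul, Real.norm_of_nonneg (by positivity), Real.norm_eq_abs]
    by_cases hx : x - c ∈ Set.Icc (-1 : ℝ) 1
    · rw [Set.indicator_of_mem hx]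
      exact le_add_of_le_of_nonneg (by gcongr; exact hC' x) (abs_nonneg _)
    · rw [Set.indicator_of_notMem hx, zero_mul, zero_add]
      refine mul_le_of_le_one_left (abs_nonneg _) (inv_le_one_of_one_le₀ ?_)
      rw [Real.one_le_sqrt]
      by_contra! h
      exact hx (abs_le.1 h.le)

theorem norm_pow_sub_pow_le_of_norm_le_one {z w : ℂ} (hz : ‖z‖ ≤ 1) (hw : ‖w‖ ≤ 1) (n : ℕ) :
    ‖z ^ n - w ^ n‖ ≤ n * ‖z - w‖ := by
  induction n with
  | zero => simp
  | succ n ih =>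
    have e : z ^ (n + 1) - w ^ (n + 1) = z ^ n * (z - w) + (z ^ n - w ^ n) * w := by ring
    have hzn : ‖z ^ n‖ ≤ 1 := by rw [norm_pow]; exact pow_le_one₀ (norm_nonneg _) hz
    rw [e]
    refine (norm_add_le _ _).trans ?_
    rw [norm_mul, norm_mul]
    have h1 := mul_le_of_le_one_left (norm_nonneg (z - w)) hzn
    have h2 := mul_le_of_le_one_right (norm_nonneg (z ^ n - w ^ n)) hw
    push_cast
    linarith

theorem sq_norm_invJoukowsky_ofReal_le (y : ℝ) : ‖invJoukowsky y‖ ^ 2 ≤ 2 * (1 + y ^ 2)⁻¹ := by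
  have h1 := norm_invJoukowsky_le_one (z := y) (by simp)
  have h2 := norm_invJoukowsky_mul_norm_le_one (z := y) (by simp)
  rw [Complex.norm_real, Real.norm_eq_abs] at h2
  rw [← div_eq_mul_inv, le_div_iff₀ (by positivity), mul_add, ← sq_abs y, ← mul_pow, mul_one]
  have := pow_le_one₀ (n := 2) (norm_nonneg _) h1
  have := pow_le_one₀ (n := 2) (by positivity) h2
  linarith

/-- The square-root Laplacian of a real-linear combination of the real and imaginary parts of the
boundary values of `(z - √(z² - 1))ⁿ`, transplanted to the interval `[a, b]`. -/
theorem fracLaplacian_re_invJoukowsky_pow {a b : ℝ} (hab : a < b) {κ : ℂ} (hκ : ‖κ‖ ≤ 1) {n : ℕ}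
    (hn : 1 ≤ n) {u g : ℝ → ℝ} (hu : ∀ y, u y = (κ * invJoukowsky y ^ n).re)
    (hg : ∀ y : ℝ, y ≠ 1 → y ≠ -1 →
      (κ * (Complex.I * n * invJoukowsky y ^ n / upperSqrt y)).im = n * g y) :
    (∀ x : ℝ, x ≠ a → x ≠ b →
      PVExists (fracLapKernel (1 / 2) (onInterval a b u) x) x ∧
      fracLaplacian (1 / 2) (onInterval a b u) x = 2 * n / (b - a) * onInterval a b g x) ∧
    IsDistribFracLaplacian (1 / 2) (onInterval a b u)
      (fun x => 2 * n / (b - a) * onInterval a b g x) := by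
  have hba : 0 < b - a := sub_pos.2 hab
  set k : ℝ := 2 / (b - a) with hk
  set m : ℝ := (a + b) / 2 with hm
  have hk0 : 0 < k := by positivity
  set F : ℂ → ℂ := fun z => κ * invJoukowsky (k * (z - m)) ^ n with hF
  have him (z : ℂ) : ((k : ℂ) * (z - m)).im = k * z.im := by simp
  have him0 {z : ℂ} (hz : 0 ≤ z.im) : 0 ≤ ((k : ℂ) * (z - m)).im := by
    rw [him]; positivity
  have hcast (x : ℝ) : (k : ℂ) * (x - m) = (k * (x - m) : ℝ) := by push_cast; ring
  have hb1 (x : ℝ) : k * (x - m) - 1 = k * (x - b) := by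
    rw [hk, hm]; field_simp; ring
  have ha1 (x : ℝ) : k * (x - m) + 1 = k * (x - a) := by
    rw [hk, hm]; field_simp; ring
  have hn1 {x : ℝ} (hx : x ≠ b) : k * (x - m) ≠ 1 := by
    rw [← sub_ne_zero, hb1]; exact mul_ne_zero hk0.ne' (sub_ne_zero.2 hx)
  have hn2 {x : ℝ} (hx : x ≠ a) : k * (x - m) ≠ -1 := by
    rw [ne_eq, eq_neg_iff_add_eq_zero, ha1]; exact mul_ne_zero hk0.ne' (sub_ne_zero.2 hx)
  have hc : ContinuousOn F {z | 0 ≤ z.im} :=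
    continuousOn_const.mul ((continuousOn_invJoukowsky.comp (by fun_prop) fun z hz => him0 hz).pow n)
  have hderiv {z : ℂ} (hz : 0 ≤ z.im) (h1 : (k : ℂ) * (z - m) ≠ (1 : ℝ))
      (h2 : (k : ℂ) * (z - m) ≠ (-1 : ℝ)) :
      HasDerivAt F (k * (κ * (Complex.I * n * invJoukowsky (k * (z - m)) ^ n /
        upperSqrt (k * (z - m))))) z := by
    have hl : HasDerivAt (fun z : ℂ => (k : ℂ) * (z - m)) k z := by
      simpa using ((hasDerivAt_id z).sub_const (m : ℂ)).const_mul (k : ℂ)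
    refine ((((hasDerivAt_invJoukowsky (him0 hz) h1 h2).comp z hl).pow n).const_mul κ).congr_deriv ?_
    obtain ⟨p, rfl⟩ := Nat.exists_eq_add_of_le' hn
    simp only [Function.comp, Nat.add_sub_cancel, pow_succ]
    ring
  have hd : DifferentiableOn ℂ F {z | 0 < z.im} := by
    intro z hz
    have hz' : 0 < ((k : ℂ) * (z - m)).im := by rw [him]; exact mul_pos hk0 hz
    refine (hderiv (le_of_lt hz) ?_ ?_).differentiableAt.differentiableWithinAt <;>
    · intro h
      rw [h, Complex.ofReal_im] at hz'
      exact hz'.false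
  have hM (z : ℂ) (hz : 0 ≤ z.im) : ‖F z‖ ≤ 1 := by
    rw [hF, norm_mul, norm_pow]
    exact mul_le_one₀ hκ (by positivity)
      (pow_le_one₀ (norm_nonneg _) (norm_invJoukowsky_le_one (him0 hz)))
  have hueq : onInterval a b u = fun y : ℝ => (F y).re := by
    funext x
    simp only [onInterval, hu, hF, hcast]
    rfl
  have hlim {x : ℝ} (hxa : x ≠ a) (hxb : x ≠ b) :
      Tendsto (fun ε => ∫ t in Set.Ioi ε, symmKernel (onInterval a b u) x t) (𝓝[>] 0)
        (𝓝 (Real.pi * (2 * n / (b - a) * onInterval a b g x))) := by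
    have h1 : (k : ℂ) * (x - m) ≠ (1 : ℝ) := by
      rw [hcast]; exact_mod_cast hn1 hxb
    have h2 : (k : ℂ) * (x - m) ≠ (-1 : ℝ) := by
      rw [hcast]; exact_mod_cast hn2 hxa
    have h := tendsto_integral_Ioi_symmKernel_re hc hd hM
      (hderiv (z := x) (by simp) h1 h2).hasDerivWithinAt
    rw [hcast, Complex.im_ofReal_mul, hg _ (hn1 hxb) (hn2 hxa), ← hueq] at h
    convert h using 3
    rw [onInterval, hk]
    ring
  have hcu : Continuous (onInterval a b u) := by
    rw [hueq]
    exact Complex.continuous_re.comp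
      (hc.comp_continuous Complex.continuous_ofReal fun y => by simp)
  have hMu (x : ℝ) : ‖onInterval a b u x‖ ≤ 1 := by
    rw [hueq]
    exact (Complex.abs_re_le_norm _).trans (hM x (by simp))
  refine ⟨fun x hxa hxb => ?_, ?_⟩
  · obtain ⟨h1, h2⟩ := pvExists_and_fracLaplacian_eq hcu hMu (hlim hxa hxb)
    exact ⟨h1, by rw [h2, inv_mul_cancel_left₀ Real.pi_ne_zero]⟩
  have hae : ∀ᵐ x : ℝ, x ≠ a ∧ x ≠ b :=
    (Measure.ae_ne volume a).and (Measure.ae_ne volume b)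
  -- The dominating function is `π` times a Lipschitz constant of `F` at the boundary point `x`.
  refine isDistribFracLaplacian_of_dominated (M := 1) (D := fun x =>
    n * (2 * ((√k)⁻¹ * (√|x - b|)⁻¹ + (√k)⁻¹ * (√|x - a|)⁻¹) * k) * Real.pi)
    hcu hMu ?_ (hae.mono fun x hx => hlim hx.1 hx.2) ?_ ?_
  · refine (memLp_two_iff_integrable_sq hcu.aestronglyMeasurable).2 ?_
    have hi := ((integrable_inv_one_add_sq.comp_mul_left' hk0.ne').comp_sub_right m).const_mul 2
    refine hi.mono' (hcu.pow 2).aestronglyMeasurable (Eventually.of_forall fun x => ?_)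
    refine le_trans ?_ (sq_norm_invJoukowsky_ofReal_le (k * (x - m)))
    rw [norm_pow]
    gcongr
    rw [onInterval, hu]
    refine (Complex.abs_re_le_norm _).trans ?_
    rw [norm_mul, norm_pow]
    have h1 := norm_invJoukowsky_le_one (z := (k * (x - m) : ℝ)) (by simp)
    calc ‖κ‖ * ‖invJoukowsky (k * (x - m) : ℝ)‖ ^ n
        ≤ 1 * ‖invJoukowsky (k * (x - m) : ℝ)‖ ^ 1 :=
          mul_le_mul hκ (pow_le_pow_of_le_one (norm_nonneg _) h1 hn) (by positivity) zero_le_one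
      _ = _ := by rw [one_mul, pow_one]
  · filter_upwards [hae] with x hx ε hε
    rw [hueq, integral_Ioi_symmKernel_re hc hd hM x hε]
    refine (Complex.abs_im_le_norm _).trans (norm_semicircleSlope_le hε fun z hz hzr => ?_)
    have h1 : (k : ℂ) * (x - m) ≠ (1 : ℝ) := by
      rw [hcast]; exact_mod_cast hn1 hx.2
    have h2 : (k : ℂ) * (x - m) ≠ (-1 : ℝ) := by
      rw [hcast]; exact_mod_cast hn2 hx.1
    have hx0 : 0 ≤ ((k : ℂ) * (x - m)).im := him0 (by simp)
    have hJ := norm_invJoukowsky_sub_le (him0 hz) hx0 h1 h2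
    have e1 : √‖(k : ℂ) * (x - m) - (1 : ℝ)‖ = √k * √|x - b| := by
      rw [hcast, ← Complex.ofReal_sub, hb1, Complex.norm_real, Real.norm_eq_abs, abs_mul,
        abs_of_pos hk0, Real.sqrt_mul hk0.le]
    have e2 : √‖(k : ℂ) * (x - m) - (-1 : ℝ)‖ = √k * √|x - a| := by
      rw [hcast, ← Complex.ofReal_sub, sub_neg_eq_add, ha1, Complex.norm_real, Real.norm_eq_abs,
        abs_mul, abs_of_pos hk0, Real.sqrt_mul hk0.le]
    have e3 : ‖(k : ℂ) * (z - m) - k * (x - m)‖ = k * ε := by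
      rw [← mul_sub, sub_sub_sub_cancel_right, norm_mul, hzr, Complex.norm_real,
        Real.norm_of_nonneg hk0.le]
    rw [e1, e2, e3, mul_inv, mul_inv] at hJ
    calc ‖F z - F x‖
        = ‖κ‖ * ‖invJoukowsky (k * (z - m)) ^ n - invJoukowsky (k * (x - m)) ^ n‖ := by
          rw [hF, ← norm_mul, mul_sub]
      _ ≤ 1 * (n * (2 * ((√k)⁻¹ * (√|x - b|)⁻¹ + (√k)⁻¹ * (√|x - a|)⁻¹) * (k * ε))) := by
          gcongr
          refine (norm_pow_sub_pow_le_of_norm_le_one (norm_invJoukowsky_le_one (him0 hz))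
            (norm_invJoukowsky_le_one hx0) n).trans ?_
          gcongr
      _ = _ := by ring
  · intro φ
    have h := (((integrable_inv_sqrt_abs_sub_mul b φ).add
      (integrable_inv_sqrt_abs_sub_mul a φ)).const_mul (n * (2 * (√k)⁻¹ * k) * Real.pi))
    refine h.congr (Eventually.of_forall fun x => ?_)
    simp only [Pi.add_apply]
    ring

/-- `Im (F') = n Vₙ` for `F = (z - √(z² - 1))ⁿ`: outside `[-1, 1]`, `F'` is real. -/
theorem im_deriv_invJoukowsky_pow (n : ℕ) {y : ℝ} :
    (Complex.I * n * invJoukowsky y ^ n / upperSqrt y).im = n * wT n y := by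
  rw [wT]
  rcases le_or_gt |y| 1 with hy | hy
  · rw [upperSqrt_ofReal_of_abs_le hy, Complex.div_ofReal_im, mul_assoc, Complex.I_mul_im,
      ← Complex.ofReal_natCast, Complex.re_ofReal_mul, invJoukowsky_pow_re, extT, if_pos hy]
    split_ifs with h1
    · ring
    · have : y ^ 2 = 1 := by rw [← sq_abs, le_antisymm hy (not_lt.1 h1), one_pow]
      simp [this]
  · rw [upperSqrt_ofReal_of_one_lt hy, if_neg (not_lt.2 hy.le), invJoukowsky_pow_of_one_lt n hy]
    rw [show Complex.I * n * (extT n y : ℂ) / (-Complex.I * (Real.sign y * √(y ^ 2 - 1) : ℝ)) =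
      (-(n * extT n y / (Real.sign y * √(y ^ 2 - 1))) : ℝ) by
        push_cast
        rw [mul_assoc, mul_div_mul_comm, div_neg, div_self Complex.I_ne_zero]
        ring]
    rw [Complex.ofReal_im, mul_zero]

/-- `Re (F') = (n + 1) Ũₙ` for `F = (z - √(z² - 1))ⁿ⁺¹`. -/
theorem re_deriv_invJoukowsky_pow (n : ℕ) {y : ℝ} (h1 : y ≠ 1) (h2 : y ≠ -1) :
    (Complex.I * (n + 1 : ℕ) * invJoukowsky y ^ (n + 1) / upperSqrt y).re =
      (n + 1 : ℕ) * extU n y := by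
  rcases le_or_gt |y| 1 with hy | hy
  · have hlt : |y| < 1 := by
      refine lt_of_le_of_ne hy fun h => ?_
      rcases eq_or_eq_neg_of_abs_eq h with h | h
      · exact h1 h
      · exact h2 h
    have hs : √(1 - y ^ 2) ≠ 0 :=
      (Real.sqrt_pos.2 (sub_pos.2 ((sq_lt_one_iff_abs_lt_one y).2 hlt))).ne'
    rw [upperSqrt_ofReal_of_abs_le hy, Complex.div_ofReal_re, mul_assoc, Complex.I_mul_re,
      ← Complex.ofReal_natCast, Complex.im_ofReal_mul, invJoukowsky_pow_im, wU, if_pos hlt,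
      extU_of_abs_le hy]
    field_simp
  · rw [upperSqrt_ofReal_of_one_lt hy, invJoukowsky_pow_of_one_lt _ hy, extU_of_one_lt hy]
    have hsgn : Real.sign y = (Real.sign y)⁻¹ := by
      rcases lt_abs.1 hy with h | h
      · rw [Real.sign_of_pos (by linarith)]; norm_num
      · rw [Real.sign_of_neg (by linarith)]; norm_num
    rw [show Complex.I * (n + 1 : ℕ) * (extT (n + 1) y : ℂ) /
      (-Complex.I * (Real.sign y * √(y ^ 2 - 1) : ℝ)) =
      (-((n + 1 : ℕ) * extT (n + 1) y / (Real.sign y * √(y ^ 2 - 1))) : ℝ) by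
        push_cast
        rw [mul_assoc, mul_div_mul_comm, div_neg, div_self Complex.I_ne_zero]
        ring]
    rw [Complex.ofReal_re]
    nth_rewrite 2 [hsgn]
    rw [div_eq_mul_inv, div_eq_mul_inv, mul_inv]
    ring

end SumSpace

theorem mainTheorem1 (a b : ℝ) (hab : a < b) :
    (∀ n : ℕ, 1 ≤ n →
      (∀ x : ℝ, x ≠ a → x ≠ b →
        SumSpace.PVExists
          (SumSpace.fracLapKernel (1 / 2) (SumSpace.onInterval a b (SumSpace.extT n)) x) x ∧
        SumSpace.fracLaplacian (1 / 2) (SumSpace.onInterval a b (SumSpace.extT n)) x =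
          2 * n / (b - a) * SumSpace.onInterval a b (SumSpace.wT n) x) ∧
      SumSpace.IsDistribFracLaplacian (1 / 2) (SumSpace.onInterval a b (SumSpace.extT n))
        (fun x => 2 * n / (b - a) * SumSpace.onInterval a b (SumSpace.wT n) x)) ∧
    (∀ n : ℕ,
      (∀ x : ℝ, x ≠ a → x ≠ b →
        SumSpace.PVExists
          (SumSpace.fracLapKernel (1 / 2) (SumSpace.onInterval a b (SumSpace.wU n)) x) x ∧
        SumSpace.fracLaplacian (1 / 2) (SumSpace.onInterval a b (SumSpace.wU n)) x =
          2 * (n + 1) / (b - a) * SumSpace.onInterval a b (SumSpace.extU n) x) ∧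
      SumSpace.IsDistribFracLaplacian (1 / 2) (SumSpace.onInterval a b (SumSpace.wU n))
        (fun x => 2 * (n + 1) / (b - a) * SumSpace.onInterval a b (SumSpace.extU n) x)) := by
  refine ⟨fun n hn => ?_, fun n => ?_⟩
  · refine SumSpace.fracLaplacian_re_invJoukowsky_pow hab (κ := 1) (by simp) hn (fun y => ?_)
      fun y _ _ => ?_
    · rw [one_mul, SumSpace.invJoukowsky_pow_re]
    · rw [one_mul, SumSpace.im_deriv_invJoukowsky_pow]
  · have h := SumSpace.fracLaplacian_re_invJoukowsky_pow hab (κ := Complex.I) (by simp)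
      (Nat.le_add_left 1 n) (u := SumSpace.wU n) (g := SumSpace.extU n) (fun y => ?_)
      fun y h1 h2 => ?_
    · simpa only [Nat.cast_succ] using h
    · rw [Complex.I_mul_re, SumSpace.invJoukowsky_pow_im, neg_neg]
    · rw [Complex.I_mul_im, SumSpace.re_deriv_invJoukowsky_pow n h1 h2]
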